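/- Let $\lambda_0=\frac{3-\sqrt5}{2}$ and $\kappa=\frac{2}{\lambda_0}=3+\sqrt5\approx 5.236$. There is a polynomial $p$ (one and the same for all the data below) with the following property. Let $d,m,B\in\mathbb Z_{\ge 0}$, let $g_1,\dots,g_m:\mathbb R^{2}\times\mathbb R^{d}\to\mathbb R$ be convex, and suppose that $S:=\{(x,y): g_i(x,y)\le 0 \text{ for } 1\le i\le m\}$ is contained in $[-B,B]^2\times\mathbb R^d$ and that for every $x\in\mathbb R^2$ the minimum $g(x):=\min_{y\in\mathbb R^d}\max_{1\le i\le m}g_i(x,y)$ is attained. Let $\gamma>0$ and $V_f\in\mathbb R$ be given. Then there is a deterministic adaptive query algorithm, depending only on these data and on its input point $z=(x,y)\in S$, such that the following holds for every convex function $f:\mathbb R^{2}\times\mathbb R^{d}\to\mathbb R_+\cup\{+\infty\}$ that is finite on $S$ and has spread $\sup\{f(z_1)-f(z_2): z_1,z_2\in S\}\le V_f$, and for every map $x\mapsto y_x$ which, with $\phi(x):=\inf\{f(x,y):(x,y)\in S\}$, satisfies $$(x,y_x)\in S\quad\text{and}\quad f(x,y_x)-\gamma\le\phi(x)\qquad\text{for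 every } x\in\mathbb R^2 \text{ with } g(x)\le 0 .$$ The algorithm has access to $f$ and to $x\mapsto y_x$ only by asking for values $f(x',y')$ and for points $y_{x'}$ at points of its choice, and for every $z\in S$ it implements the improvement oracle $\mathrm O_{0,\kappa\gamma}(z)$, that is, it stops and (a) returns a point $\hat z\in S\cap(\mathbb Z^2\times\mathbb R^d)$ with $f(\hat z)\le f(z)+\kappa\gamma$, and/or (b) asserts correctly that there is no $\hat z\in S\cap(\mathbb Z^2\times\mathbb R^d)$ with $f(\hat z)\le f(z)$. It uses at most $p\big(\ln^+(V_f/\gamma)\big)$ evaluations of $f$, and at most as many approximate partial minimizations $x'\mapsto y_{x'}$, where $\ln^+(t)=\max\{0,\ln t\}$ for $t>0$ and $\ln^+(0)=0$. -/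

import Mathlib

open scoped NNReal ENNReal

namespace MixedInteger

/-- The space of pairs `(x, y)` with `n` (integer) variables `x` and `d` continuous variables `y`. -/
abbrev Point (n d : ℕ) : Type := (Fin n → ℝ) × (Fin d → ℝ)

/-- The mixed-integer lattice `ℤⁿ × ℝᵈ` inside `ℝⁿ × ℝᵈ`. -/
def mixedLattice (n d : ℕ) : Set (Point n d) :=
  {z | ∀ i, ∃ k : ℤ, z.1 i = (k : ℝ)}

/-- The feasible set `S = {z | g_i(z) ≤ 0 for all i}`. -/
def feasibleSet {n d m : ℕ} (g : Fin m → Point n d → ℝ) : Set (Point n d) :=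
  {z | ∀ i, g i z ≤ 0}

/-- The pointwise maximum `z ↦ max_i g_i(z)` of the (finitely many) constraint functions. -/
noncomputable def maxConstraint {n d m : ℕ} (g : Fin m → Point n d → ℝ) (z : Point n d) : ℝ :=
  ⨆ i, g i z

/-- The function `x ↦ min_y max_i g_i(x, y)`. It is only used when the minimum is attained. -/
noncomputable def partialConstraint {n d m : ℕ} (g : Fin m → Point n d → ℝ)
    (x : Fin n → ℝ) : ℝ :=
  ⨅ y : Fin d → ℝ, maxConstraint g (x, y)

/-- The partial minimization function `φ(x) = inf {f(x, y) | (x, y) ∈ S}`, which is `+∞` when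
no `y` satisfies `(x, y) ∈ S`. -/
noncomputable def partialMin {n d : ℕ} (S : Set (Point n d)) (f : Point n d → ℝ≥0∞)
    (x : Fin n → ℝ) : ℝ≥0∞ :=
  ⨅ (y : Fin d → ℝ) (_ : (x, y) ∈ S), f (x, y)

/-- The points at which the golden-section search on `[0, 1]` evaluates: `λ₀` is determined by
`λ₁ = 1 - λ₀` and `λ₁ ^ 2 = λ₀`. -/
noncomputable def lambda0 : ℝ := (3 - √5) / 2

/-- The constant `κ = 2 / λ₀ ≈ 5.236`. -/
noncomputable def kappa : ℝ := 2 / lambda0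

theorem lambda0_spec : 0 < lambda0 ∧ lambda0 < 1 - lambda0 ∧ (1 - lambda0) ^ 2 = lambda0 := by
  have h5 : √5 ^ 2 = 5 := Real.sq_sqrt (by norm_num)
  have h0 : 0 ≤ √5 := Real.sqrt_nonneg 5
  unfold lambda0
  refine ⟨by nlinarith, by nlinarith, by nlinarith⟩

/-- The possible reports of an improvement oracle: a point (report **a**), the assertion that
there is no suitable point (report **b**), or both. -/
inductive OracleReport (n d : ℕ) : Type
  | point (w : Point n d)
  | noPoint
  | both (w : Point n d)

/-- `w` may be returned by the oracle `O_{α,δ}(z)`: it is a feasible mixed-integer point with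
`f(w) ≤ (1 + α) f(z) + δ`. -/
def IsImproving {n d : ℕ} (α δ : ℝ≥0∞) (S : Set (Point n d)) (f : Point n d → ℝ≥0∞)
    (z w : Point n d) : Prop :=
  w ∈ S ∩ mixedLattice n d ∧ f w ≤ (1 + α) * f z + δ

/-- There is no feasible mixed-integer point `w` with `f(w) ≤ f(z)`. -/
def NoBetterPoint {n d : ℕ} (S : Set (Point n d)) (f : Point n d → ℝ≥0∞)
    (z : Point n d) : Prop :=
  ¬ ∃ w ∈ S ∩ mixedLattice n d, f w ≤ f z

/-- The report is a legitimate answer of the improvement oracle `O_{α,δ}` queried at `z`. -/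
def OracleReport.IsCorrect {n d : ℕ} (α δ : ℝ≥0∞) (S : Set (Point n d))
    (f : Point n d → ℝ≥0∞) (z : Point n d) : OracleReport n d → Prop
  | .point w => IsImproving α δ S f z w
  | .noPoint => NoBetterPoint S f z
  | .both w => IsImproving α δ S f z w ∧ NoBetterPoint S f z

/-- A deterministic adaptive algorithm that has access to the objective function `f` and to an
approximate partial minimizer `x ↦ y_x` only through queries. It either stops with a report, or
asks for the value of `f` at a point, or asks for the point `y_x` belonging to some `x`; how it
goes on may depend on the answer. -/
inductive QueryAlgorithm (n d : ℕ) : Type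
  | halt (r : OracleReport n d)
  | evaluate (z : Point n d) (next : ℝ≥0∞ → QueryAlgorithm n d)
  | minimize (x : Fin n → ℝ) (next : (Fin d → ℝ) → QueryAlgorithm n d)

namespace QueryAlgorithm

variable {n d : ℕ}

/-- The report of the algorithm when the queries are answered by `f` and by `x ↦ ymin x`. -/
def output (f : Point n d → ℝ≥0∞) (ymin : (Fin n → ℝ) → (Fin d → ℝ)) :
    QueryAlgorithm n d → OracleReport n d
  | halt r => r
  | evaluate z next => output f ymin (next (f z))
  | minimize x next => output f ymin (next (ymin x))

/-- The number of evaluations of `f` in the run of the algorithm on `f` and `ymin`. -/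
def evaluations (f : Point n d → ℝ≥0∞) (ymin : (Fin n → ℝ) → (Fin d → ℝ)) :
    QueryAlgorithm n d → ℕ
  | halt _ => 0
  | evaluate z next => evaluations f ymin (next (f z)) + 1
  | minimize x next => evaluations f ymin (next (ymin x))

/-- The number of approximate partial minimizations in the run of the algorithm on `f`
and `ymin`. -/
def minimizations (f : Point n d → ℝ≥0∞) (ymin : (Fin n → ℝ) → (Fin d → ℝ)) :
    QueryAlgorithm n d → ℕ
  | halt _ => 0
  | evaluate z next => minimizations f ymin (next (f z))
  | minimize x next => minimizations f ymin (next (ymin x)) + 1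

end QueryAlgorithm

end MixedInteger

/-! Minimizing out the continuous variables turns `f` into a convex function `φ` on the projection
of `S` to the plane, known up to `γ` through the points `y_x`. Let `L = f z`, let `p` be the
`x`-part of `z`, and let `K` be the hull of `p` and the lattice points of the projection. The cost
must not depend on the number of lattice points in `K`, and there are no subgradients to cut with.

The first obstacle is met by contraction. Take `n ≥ V / γ`. Shrinking `K` by `1 / n` towards a point
with `φ ≤ L` leaves only points with `φ ≤ L + γ`. If the copy shrunk towards `p` holds a lattice
point, that point can be returned. Otherwise a flatness argument (`exists_hitting_set`) gives a set
`A` of at most `(4 * n + 1) ^ 2` lattice points that meets every copy shrunk towards a lattice point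
of `K`. So `φ > L + γ` on `A` already proves that no feasible lattice point is as good as `z`.

The second obstacle is met by `exists_cut`. The Helly number four of the lattice plane provides a
lattice point `c` such that every closed half-plane bounded by a line through `c` holds a quarter of
the remaining candidates. Some direction `v` then makes both cones `c - cone(p - c, ±v)` hold a
sixteenth. Sublevel sets of `φ` at levels at least `L` are convex and contain `p`. So if `c` is bad,
a low value on the ray from `c` along `v` excludes the candidates in the cone of `v`, and the
absence of low values excludes those in the cone of `-v`. A one-dimensional search decides between
the two up to a multiple of `γ`. Logarithmically many rounds with logarithmically many queries each
suffice. -/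

namespace MixedInteger

/-! ### Helly number of the lattice plane and lattice centerpoints -/

/-- Doignon's theorem in the plane, for finitely many lattice points: if `Z` is closed under
integral midpoints and at least five strict sublevel conditions are given such that leaving out any
one of them leaves a system solvable in `Z`, then the whole system is solvable in `Z`. -/
theorem exists_forall_lt_of_five_le_card {ι : Type*} [Fintype ι] (hι : 5 ≤ Fintype.card ι)
    (Z : Finset (Fin 2 → ℤ))
    (hZ : ∀ x ∈ Z, ∀ y ∈ Z, ∀ w : Fin 2 → ℤ, (∀ j, 2 * w j = x j + y j) → w ∈ Z)
    (h : ι → (Fin 2 → ℤ) → ℝ)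
    (hh : ∀ i x y w, (∀ j, 2 * w j = x j + y j) → 2 * h i w ≤ h i x + h i y)
    (b : ι → ℝ) (hb : ∀ j, ∃ x ∈ Z, ∀ i, i ≠ j → h i x < b i) :
    ∃ x ∈ Z, ∀ i, h i x < b i := by
  classical
  by_contra! hno
  choose X hXZ hX using hb
  have hXb : ∀ i, b i ≤ h i (X i) := by
    intro i
    obtain ⟨k, hk⟩ := hno (X i) (hXZ i)
    by_cases hki : k = i
    · exact hki ▸ hk
    · exact absurd (hX i k hki) (not_lt.2 hk)
  -- `T` holds the raised thresholds `h i (ζ i) ≥ b i` that leave the system unsolvable in `Z`. It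
  -- is finite, and where the sum is largest no single threshold can be raised.
  let T : Set (ι → Z) := {ζ | (∀ i, b i ≤ h i (ζ i)) ∧
    ∀ z ∈ Z, ∃ i, h i (ζ i) ≤ h i z}
  have hT : T.Nonempty := by
    -- Rounding `b i` up to the next value of `h i` on `Z` does not change the strict condition on
    -- `Z`.
    have : ∀ i, ∃ ζ : Z, b i ≤ h i ζ ∧ ∀ z ∈ Z, b i ≤ h i z → h i ζ ≤ h i z := by
      intro i
      obtain ⟨ζ, hζ, hmin⟩ := Finset.exists_min_image (Z.filter fun z => b i ≤ h i z) (h i)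
        ⟨X i, Finset.mem_filter.2 ⟨hXZ i, hXb i⟩⟩
      rw [Finset.mem_filter] at hζ
      exact ⟨⟨ζ, hζ.1⟩, hζ.2, fun z hz hbz => hmin z (Finset.mem_filter.2 ⟨hz, hbz⟩)⟩
    choose ζ hζ hmin using this
    refine ⟨ζ, hζ, fun z hz => ?_⟩
    obtain ⟨i, hi⟩ := hno z hz
    exact ⟨i, hmin i z hz hi⟩
  obtain ⟨ζ, ⟨hζb, hζ⟩, hmax⟩ := Set.exists_max_image T (fun ζ => ∑ i, h i (ζ i))
    (Set.toFinite T) hT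
  have hy : ∀ j, ∃ y ∈ Z, h j y = h j (ζ j) ∧ ∀ i, i ≠ j → h i y < h i (ζ i) := by
    intro j
    obtain ⟨y, hy, hmin⟩ := Finset.exists_min_image
      (Z.filter fun z => ∀ i, i ≠ j → h i z < h i (ζ i)) (h j)
      ⟨X j, Finset.mem_filter.2 ⟨hXZ j, fun i hi => (hX j i hi).trans_le (hζb i)⟩⟩
    rw [Finset.mem_filter] at hy
    have hge : h j (ζ j) ≤ h j y := by
      obtain ⟨i, hi⟩ := hζ y hy.1
      by_cases hij : i = j
      · exact hij ▸ hi
      · exact absurd (hy.2 i hij) (not_lt.2 hi)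
    refine ⟨y, hy.1, le_antisymm ?_ hge, hy.2⟩
    -- As `y` minimizes `h j` under the other conditions, threshold `j` may be raised to `h j y`;
    -- maximality then forces equality.
    let ζ' : ι → Z := Function.update ζ j ⟨y, hy.1⟩
    have hj : ζ' j = ⟨y, hy.1⟩ := Function.update_self ..
    have hi : ∀ i, i ≠ j → ζ' i = ζ i := fun i hij => Function.update_of_ne hij ..
    have hT' : ζ' ∈ T := by
      refine ⟨fun i => ?_, fun z hz => ?_⟩
      · by_cases hij : i = j
        · subst hij; rw [hj]; exact (hζb i).trans hge
        · rw [hi i hij]; exact hζb i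
      · by_contra! hlt
        have h1 : ∀ i, i ≠ j → h i z < h i (ζ i) := fun i hij => by
          have := hlt i
          rwa [hi i hij] at this
        have h2 := hlt j
        rw [hj] at h2
        exact absurd (hmin z (Finset.mem_filter.2 ⟨hz, h1⟩)) (not_le.2 h2)
    have hle := hmax ζ' hT'
    have e1 := Finset.add_sum_erase Finset.univ (fun i => h i (ζ i)) (Finset.mem_univ j)
    have e2 := Finset.add_sum_erase Finset.univ (fun i => h i (ζ' i)) (Finset.mem_univ j)
    have e3 : ∑ i ∈ Finset.univ.erase j, h i (ζ' i) = ∑ i ∈ Finset.univ.erase j, h i (ζ i) :=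
      Finset.sum_congr rfl fun i hi' => by rw [hi i (Finset.ne_of_mem_erase hi')]
    simp only [hj] at e2 hle
    linarith
  choose Y hYZ hYj hYi using hy
  -- At least five points fall into four parity classes. Each condition is tight at no more than one
  -- of `Y j` and `Y k`, so their midpoint satisfies all conditions strictly.
  obtain ⟨j, k, hjk, hpar⟩ : ∃ j k, j ≠ k ∧
      (fun l => ((Y j l : ℤ) : ZMod 2)) = fun l => ((Y k l : ℤ) : ZMod 2) := by
    apply Fintype.exists_ne_map_eq_of_card_lt (fun j => fun l : Fin 2 => ((Y j l : ℤ) : ZMod 2))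
    simp [ZMod.card]
    omega
  have hev : ∀ l, ∃ w, 2 * w = Y j l + Y k l := by
    intro l
    have := congrFun hpar l
    rw [ZMod.intCast_eq_intCast_iff_dvd_sub] at this
    obtain ⟨w, hw⟩ := this
    exact ⟨Y j l + w, by push_cast at hw; linarith⟩
  choose w hw using hev
  obtain ⟨i, hi⟩ := hζ w (hZ _ (hYZ j) _ (hYZ k) w hw)
  have hmid := hh i _ _ w hw
  by_cases hij : i = j
  · subst hij
    have := hYi k i hjk
    have := hYj i
    linarith
  · have := hYi j i hij
    by_cases hik : i = k
    · subst hik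
      have := hYj i
      linarith
    · have := hYi k i hik
      linarith

/-- An unsolvable finite system of strict sublevel conditions on lattice points in the plane has
an unsolvable subsystem of at most four conditions. -/
theorem exists_subset_card_le_four {ι : Type*} (I : Finset ι) (Z : Finset (Fin 2 → ℤ))
    (hZ : ∀ x ∈ Z, ∀ y ∈ Z, ∀ w : Fin 2 → ℤ, (∀ j, 2 * w j = x j + y j) → w ∈ Z)
    (h : ι → (Fin 2 → ℤ) → ℝ)
    (hh : ∀ i x y w, (∀ j, 2 * w j = x j + y j) → 2 * h i w ≤ h i x + h i y)
    (b : ι → ℝ) (hI : ∀ x ∈ Z, ∃ i ∈ I, b i ≤ h i x) :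
    ∃ J ⊆ I, J.card ≤ 4 ∧ ∀ x ∈ Z, ∃ i ∈ J, b i ≤ h i x := by
  classical
  induction I using Finset.strongInduction with
  | H I ih =>
    by_cases hc : I.card ≤ 4
    · exact ⟨I, subset_rfl, hc, hI⟩
    by_cases hex : ∃ j ∈ I, ∀ x ∈ Z, ∃ i ∈ I.erase j, b i ≤ h i x
    · obtain ⟨j, hj, hj'⟩ := hex
      obtain ⟨J, hJ, hJ'⟩ := ih _ (Finset.erase_ssubset hj) hj'
      exact ⟨J, hJ.trans (Finset.erase_subset _ _), hJ'⟩
    · push Not at hex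
      exfalso
      obtain ⟨x, hx, hx'⟩ := exists_forall_lt_of_five_le_card (ι := I) (by simp; omega) Z hZ
        (fun i => h i) (fun i => hh i) (fun i => b i) (fun j => by
          obtain ⟨x, hx, hx'⟩ := hex j j.2
          exact ⟨x, hx, fun i hij => hx' i (Finset.mem_erase.2
            ⟨fun e => hij (Subtype.ext e), i.2⟩)⟩)
      obtain ⟨i, hi, hi'⟩ := hI x hx
      exact absurd (hx' ⟨i, hi⟩) (not_lt.2 hi')

/-- Every finite set of lattice points in the plane has a lattice centerpoint: a lattice point such
that each closed half-plane with this point on its boundary holds a quarter of the set. -/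
theorem exists_lattice_centerpoint (Z A : Finset (Fin 2 → ℤ)) (hA : A ⊆ Z) (hne : A.Nonempty)
    (hZ : ∀ x ∈ Z, ∀ y ∈ Z, ∀ w : Fin 2 → ℤ, (∀ j, 2 * w j = x j + y j) → w ∈ Z) :
    ∃ c ∈ Z, ∀ a₀ a₁ : ℝ,
      A.card ≤ 4 * (A.filter fun x => a₀ * c 0 + a₁ * c 1 ≤ a₀ * x 0 + a₁ * x 1).card := by
  classical
  by_contra! hno
  choose! a₀ a₁ ha using hno
  -- Every `c` violates its own condition, so the system is unsolvable. At most four of the bad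
  -- half-planes then cover `A`, although each holds less than a quarter of it.
  obtain ⟨J, hJZ, hJ, hJ'⟩ := exists_subset_card_le_four Z Z hZ
    (fun c x => a₀ c * x 0 + a₁ c * x 1)
    (by
      intro c x y w hw
      have h0 : (2 * w 0 : ℝ) = x 0 + y 0 := by exact_mod_cast hw 0
      have h1 : (2 * w 1 : ℝ) = x 1 + y 1 := by exact_mod_cast hw 1
      apply le_of_eq
      linear_combination a₀ c * h0 + a₁ c * h1)
    (fun c => a₀ c * c 0 + a₁ c * c 1) (fun x hx => ⟨x, hx, le_rfl⟩)
  have hsub : A ⊆ J.biUnion fun c =>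
      A.filter fun x => a₀ c * c 0 + a₁ c * c 1 ≤ a₀ c * x 0 + a₁ c * x 1 := by
    intro x hx
    obtain ⟨c, hc, hc'⟩ := hJ' x (hA hx)
    exact Finset.mem_biUnion.2 ⟨c, hc, Finset.mem_filter.2 ⟨hx, hc'⟩⟩
  have h1 := (Finset.card_le_card hsub).trans Finset.card_biUnion_le
  rcases J.eq_empty_or_nonempty with rfl | hJne
  · simp at h1
    exact hne.ne_empty h1
  have h2 : ∑ c ∈ J, 4 * (A.filter fun x =>
      a₀ c * c 0 + a₁ c * c 1 ≤ a₀ c * x 0 + a₁ c * x 1).card < ∑ c ∈ J, A.card :=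
    Finset.sum_lt_sum_of_nonempty hJne fun c hc => ha c (hJZ hc)
  rw [← Finset.mul_sum, Finset.sum_const, smul_eq_mul] at h2
  have h3 : J.card * A.card ≤ 4 * A.card := Nat.mul_le_mul_right _ hJ
  omega

/-! ### Balanced pairs of cones at a centerpoint -/

open Classical in
/-- If every closed half-plane bounded by a line through `c` holds a quarter of the finite set `R`,
then for every `u ≠ 0` there is a direction `v` such that both of the cones `c - cone(u, v)` and
`c - cone(u, -v)` hold a sixteenth of `R`. -/
theorem exists_balanced_direction (R : Finset (Fin 2 → ℤ)) (c : Fin 2 → ℤ) (u : Fin 2 → ℝ)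
    (hu : u ≠ 0)
    (hc : ∀ a₀ a₁ : ℝ,
      R.card ≤ 4 * (R.filter fun x => a₀ * c 0 + a₁ * c 1 ≤ a₀ * x 0 + a₁ * x 1).card) :
    ∃ v : Fin 2 → ℝ,
      R.card ≤ 16 * (R.filter fun x : Fin 2 → ℤ => ∃ i j : ℝ, 0 ≤ i ∧ 0 ≤ j ∧
        ∀ l, (x l : ℝ) = c l - i * u l - j * v l).card ∧
      R.card ≤ 16 * (R.filter fun x : Fin 2 → ℤ => ∃ i j : ℝ, 0 ≤ i ∧ 0 ≤ j ∧
        ∀ l, (x l : ℝ) = c l - i * u l + j * v l).card := by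
  set D : ℝ := u 0 ^ 2 + u 1 ^ 2 with hD
  have hDpos : 0 < D := by
    have : u 0 ≠ 0 ∨ u 1 ≠ 0 := by
      by_contra! h
      exact hu (by ext l; fin_cases l <;> simp [h.1, h.2])
    rcases this with h | h
    · have := sq_pos_of_ne_zero h; nlinarith [sq_nonneg (u 1)]
    · have := sq_pos_of_ne_zero h; nlinarith [sq_nonneg (u 0)]
  -- Up to the factor `|u|`, `α` and `β` are the coordinates of `x - c` along and across `u`, and
  -- `τ` is the cotangent of the angle to `u`.
  let α : (Fin 2 → ℤ) → ℝ := fun x => u 0 * (x 0 - c 0) + u 1 * (x 1 - c 1)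
  let β : (Fin 2 → ℤ) → ℝ := fun x => u 0 * (x 1 - c 1) - u 1 * (x 0 - c 0)
  have hx0 : ∀ x, (x 0 : ℝ) - c 0 = (α x * u 0 - β x * u 1) / D := by
    intro x; rw [eq_div_iff hDpos.ne']; simp only [α, β, hD]; ring
  have hx1 : ∀ x, (x 1 : ℝ) - c 1 = (α x * u 1 + β x * u 0) / D := by
    intro x; rw [eq_div_iff hDpos.ne']; simp only [α, β, hD]; ring
  let τ : (Fin 2 → ℤ) → ℝ := fun x => α x / β x
  let F : ℝ → ℕ := fun t => (R.filter fun x => 0 < β x ∧ τ x ≤ t).card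
  let G : ℝ → ℕ := fun t => (R.filter fun x => β x < 0 ∧ t ≤ τ x).card
  let O : ℕ := (R.filter fun x => β x = 0 ∧ α x ≤ 0).card
  by_cases hO : R.card ≤ 16 * O
  · have hsub : O ≤ (R.filter fun x : Fin 2 → ℤ => ∃ i j : ℝ, 0 ≤ i ∧ 0 ≤ j ∧
        ∀ l, (x l : ℝ) = c l - i * u l).card := by
      refine Finset.card_le_card fun x hx => ?_
      rw [Finset.mem_filter] at hx ⊢
      obtain ⟨hxR, hβ, hα⟩ := hx
      refine ⟨hxR, -α x / D, 0, div_nonneg (by linarith) hDpos.le, le_rfl, fun l => ?_⟩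
      have h0 := hx0 x
      have h1 := hx1 x
      rw [hβ] at h0 h1
      fin_cases l
      · simp only [Fin.zero_eta]; linear_combination h0
      · simp only [Fin.mk_one]; linear_combination h1
    refine ⟨0, ?_, ?_⟩ <;> simp only [Pi.zero_apply, mul_zero, sub_zero, add_zero] <;> omega
  -- The half-plane `α ≤ t * β` is made up of the points counted by `F t`, `G t` and `O`. As `O` is
  -- below a sixteenth, `F t` or `G t` reaches a sixteenth for every `t`.
  have hFG : ∀ t, R.card ≤ 4 * (F t + G t + O) := by
    intro t
    refine (hc (-(u 0) - t * u 1) (-(u 1) + t * u 0)).trans (Nat.mul_le_mul_left _ ?_)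
    refine le_trans (Finset.card_le_card (fun x hx => ?_))
      ((Finset.card_union_le _ _).trans (Nat.add_le_add_right (Finset.card_union_le _ _) _))
    rw [Finset.mem_filter] at hx
    have hx' : α x ≤ t * β x := by
      simp only [α, β]; linarith [hx.2]
    simp only [Finset.mem_union, Finset.mem_filter, hx.1, true_and]
    rcases lt_trichotomy (β x) 0 with h | h | h
    · exact Or.inl (Or.inr ⟨h, (le_div_iff_of_neg h).2 hx'⟩)
    · exact Or.inr ⟨h, by simpa [h] using hx'⟩
    · exact Or.inl (Or.inl ⟨h, (div_le_iff₀ h).2 hx'⟩)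
  have hRpos : 0 < R.card := by omega
  have hmono : ∀ s t, (∀ x ∈ R, 0 < β x → τ x ≤ s → τ x ≤ t) → F s ≤ F t := by
    intro s t hst
    refine Finset.card_le_card fun x hx => ?_
    rw [Finset.mem_filter] at hx ⊢
    exact ⟨hx.1, hx.2.1, hst x hx.1 hx.2.1 hx.2.2⟩
  have hstep : ∀ t, R.card ≤ 16 * F t →
      ∃ x ∈ R, 0 < β x ∧ τ x ≤ t ∧ R.card ≤ 16 * F (τ x) := by
    intro t ht
    have hne : (R.filter fun x => 0 < β x ∧ τ x ≤ t).Nonempty := by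
      rw [← Finset.card_pos]
      change 0 < F t
      omega
    obtain ⟨y, hy, hmax⟩ := Finset.exists_max_image _ τ hne
    rw [Finset.mem_filter] at hy
    refine ⟨y, hy.1, hy.2.1, hy.2.2, ht.trans (Nat.mul_le_mul_left _ (hmono _ _ ?_))⟩
    exact fun x hx hβ hτ => hmax x (Finset.mem_filter.2 ⟨hx, hβ, hτ⟩)
  have hex : (R.filter fun x => 0 < β x ∧ R.card ≤ 16 * F (τ x)).Nonempty := by
    obtain ⟨t, ht⟩ : ∃ t, ∀ x ∈ R, τ x < t := by
      obtain ⟨M, hM⟩ := (R.image τ).bddAbove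
      exact ⟨M + 1, fun x hx => by
        have := hM (Finset.mem_coe.2 (Finset.mem_image_of_mem τ hx)); linarith⟩
    have hG : G t = 0 := by
      rw [Finset.card_eq_zero, Finset.filter_eq_empty_iff]
      exact fun x hx h => absurd (ht x hx) (not_lt.2 h.2)
    have := hFG t
    obtain ⟨x, hx, hβ, -, hF⟩ := hstep t (by omega)
    exact ⟨x, Finset.mem_filter.2 ⟨hx, hβ, hF⟩⟩
  -- `τ y` is the first cotangent at which `F` reaches a sixteenth. Just below it `F` does not, so
  -- `G` does; `t` is chosen so close that `G` loses no points between `t` and `τ y`.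
  obtain ⟨y, hy, hmin⟩ := Finset.exists_min_image _ τ hex
  rw [Finset.mem_filter] at hy
  have hGy : R.card ≤ 16 * G (τ y) := by
    obtain ⟨t, hty, ht⟩ : ∃ t < τ y, ∀ x ∈ R, τ x < τ y → τ x < t := by
      have h : ∀ᶠ t in nhdsWithin (τ y) (Set.Iio (τ y)), ∀ x ∈ R, τ x < τ y → τ x < t := by
        rw [Filter.eventually_all_finset]
        intro x _
        by_cases hx : τ x < τ y
        · filter_upwards [Ioo_mem_nhdsLT hx] with t ht _ using ht.1
        · exact Filter.Eventually.of_forall fun t h => absurd h hx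
      obtain ⟨t, ht, ht'⟩ := (h.and self_mem_nhdsWithin).exists
      exact ⟨t, ht', ht⟩
    have hF : ¬ R.card ≤ 16 * F t := by
      intro hF
      obtain ⟨x, hx, hβ, hxt, hFx⟩ := hstep t hF
      exact absurd (hmin x (Finset.mem_filter.2 ⟨hx, hβ, hFx⟩)) (not_le.2 (hxt.trans_lt hty))
    have hle : G t ≤ G (τ y) := by
      refine Finset.card_le_card fun x hx => ?_
      rw [Finset.mem_filter] at hx ⊢
      refine ⟨hx.1, hx.2.1, ?_⟩
      by_contra! hlt
      exact absurd (ht x hx.1 hlt) (not_lt.2 hx.2.2)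
    have := hFG t
    omega
  -- This is `τ y` times `u` plus `u` turned by a right angle.
  refine ⟨![τ y * u 0 - u 1, τ y * u 1 + u 0], hGy.trans (Nat.mul_le_mul_left _ ?_),
    hy.2.2.trans (Nat.mul_le_mul_left _ ?_)⟩
  · refine Finset.card_le_card fun x hx => ?_
    rw [Finset.mem_filter] at hx ⊢
    obtain ⟨hxR, hβ, hτ⟩ := hx
    have hα : α x = τ x * β x := (div_mul_cancel₀ _ hβ.ne).symm
    have hmul : τ x * β x ≤ τ y * β x := mul_le_mul_of_nonpos_right hτ hβ.le
    refine ⟨hxR, (τ y * β x - α x) / D, -β x / D, div_nonneg (by linarith) hDpos.le,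
      div_nonneg (by linarith) hDpos.le, fun l => ?_⟩
    fin_cases l
    · have := hx0 x
      simp only [Fin.zero_eta, Matrix.cons_val_zero]; linear_combination this
    · have := hx1 x
      simp only [Fin.mk_one, Matrix.cons_val_one, Matrix.cons_val_zero]; linear_combination this
  · refine Finset.card_le_card fun x hx => ?_
    rw [Finset.mem_filter] at hx ⊢
    obtain ⟨hxR, hβ, hτ⟩ := hx
    have hα : α x = τ x * β x := (div_mul_cancel₀ _ hβ.ne').symm
    have hmul : τ x * β x ≤ τ y * β x := mul_le_mul_of_nonneg_right hτ hβ.le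
    refine ⟨hxR, (τ y * β x - α x) / D, β x / D, div_nonneg (by linarith) hDpos.le,
      div_nonneg hβ.le hDpos.le, fun l => ?_⟩
    fin_cases l
    · have := hx0 x
      simp only [Fin.zero_eta, Matrix.cons_val_zero]; linear_combination this
    · have := hx1 x
      simp only [Fin.mk_one, Matrix.cons_val_one, Matrix.cons_val_zero]; linear_combination this

/-! ### Hitting sets for contracted copies -/

/-- A convex set contains the convex combinations of any three of its points. -/
theorem mem_of_eq_combination_three {ι : Type*} {K : Set (ι → ℝ)} (hK : Convex ℝ K)
    {a b c w : ι → ℝ} (ha : a ∈ K) (hb : b ∈ K) (hc : c ∈ K) {α β γ : ℝ} (hα : 0 ≤ α) (hβ : 0 ≤ β)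
    (hγ : 0 ≤ γ) (h1 : α + β + γ = 1) (hw : ∀ l, w l = α * a l + β * b l + γ * c l) : w ∈ K := by
  have := hK.sum_mem (t := Finset.univ) (w := ![α, β, γ]) (z := ![a, b, c])
    (by intro i _; fin_cases i <;> simpa) (by simp [Fin.sum_univ_three, h1])
    (by intro i _; fin_cases i <;> simpa)
  convert this using 1
  ext l
  simp [Fin.sum_univ_three, hw l]

/-- In an interval of `M + 1` integers there are `4 * n + 1` elements that meet every copy of the
interval scaled by `1 / n` towards one of its elements. -/
theorem exists_hitting_set_interval (M n : ℕ) (hn : 0 < n) :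
    ∃ T : Finset ℕ, T.card ≤ 4 * n + 1 ∧ (∀ t ∈ T, t ≤ M) ∧
      ∀ i ≤ M, ∃ t ∈ T, n * i ≤ n * t + i ∧ n * t + i ≤ n * i + M := by
  -- `q` is `M / (2 * n)` rounded down, but at least `1`; the multiples of `q` form the hitting set.
  obtain ⟨q, hq, hMq, hq'⟩ : ∃ q : ℕ, 0 < q ∧ M < 4 * n * q ∧ (q = 1 ∨ 2 * (n * q) ≤ M) := by
    have h1 := Nat.div_add_mod M (2 * n)
    have h2 := Nat.mod_lt M (show 0 < 2 * n by omega)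
    rcases Nat.eq_zero_or_pos (M / (2 * n)) with h | h
    · exact ⟨1, one_pos, by rw [h] at h1; omega, Or.inl rfl⟩
    · refine ⟨M / (2 * n), h, ?_, Or.inr ?_⟩
      · have : n * 1 ≤ n * (M / (2 * n)) := Nat.mul_le_mul_left _ h
        nlinarith
      · rw [← Nat.mul_assoc]; omega
  refine ⟨(Finset.range (M + 1)).filter fun t => q ∣ t, ?_, ?_, ?_⟩
  · have hsub : ((Finset.range (M + 1)).filter fun t => q ∣ t) ⊆
        (Finset.range (4 * n + 1)).image fun j => q * j := by
      intro t ht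
      rw [Finset.mem_filter, Finset.mem_range] at ht
      obtain ⟨ht, j, rfl⟩ := ht
      refine Finset.mem_image.2 ⟨j, Finset.mem_range.2 ?_, rfl⟩
      by_contra! hj
      have : q * (4 * n + 1) ≤ q * j := Nat.mul_le_mul_left _ hj
      nlinarith
    simpa using (Finset.card_le_card hsub).trans Finset.card_image_le
  · intro t ht
    rw [Finset.mem_filter, Finset.mem_range] at ht
    omega
  · intro i hi
    simp only [Finset.mem_filter, Finset.mem_range]
    have hdm := Nat.div_add_mod i q
    have hmod := Nat.mod_lt i hq
    rcases hq' with rfl | hq'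
    · exact ⟨i, ⟨by omega, one_dvd _⟩, by omega, by omega⟩
    -- The copy extends by `i / n` to the left of `i` and by `(M - i) / n` to the right. The longer
    -- side has length at least `M / (2 * n) ≥ q`, so it contains a multiple of `q`.
    rcases le_total M (2 * i) with h | h
    · refine ⟨q * (i / q), ⟨by omega, dvd_mul_right _ _⟩, ?_, ?_⟩
      · nlinarith
      · exact Nat.add_le_add (Nat.mul_le_mul_left _ (by omega)) hi
    · by_cases h0 : i % q = 0
      · exact ⟨i, ⟨by omega, Nat.dvd_of_mod_eq_zero h0⟩, by omega, by omega⟩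
      · have hnq : 1 * q ≤ n * q := Nat.mul_le_mul_right _ hn
        have hle : n * (q * (i / q + 1)) ≤ n * i + n * q := by
          rw [← Nat.mul_add]
          exact Nat.mul_le_mul_left _ (by rw [Nat.mul_add]; omega)
        refine ⟨q * (i / q + 1), ⟨by rw [Nat.mul_add]; omega, dvd_mul_right _ _⟩, ?_, by omega⟩
        have : n * i ≤ n * (q * (i / q + 1)) :=
          Nat.mul_le_mul_left _ (by rw [Nat.mul_add]; omega)
        omega

/-- The real vector belonging to a lattice point. -/
def latticeVec (x : Fin 2 → ℤ) : Fin 2 → ℝ := fun l => (x l : ℝ)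

/-- Hitting sets on one lattice line: `4 * n + 1` lattice points of `K` on the line suffice to meet
all copies of `K` scaled by `1 / n` towards a lattice point on the line. -/
theorem exists_hitting_set_line (K : Set (Fin 2 → ℝ)) (hK : Convex ℝ K) (Z : Finset (Fin 2 → ℤ))
    (hZ : ∀ x, x ∈ Z ↔ latticeVec x ∈ K) (n : ℕ) (hn : 0 < n) (v : Fin 2 → ℤ)
    (hv : IsCoprime (v 0) (v 1)) (k : ℤ) :
    ∃ A ⊆ Z, A.card ≤ 4 * n + 1 ∧ ∀ x ∈ Z, v 0 * x 1 - v 1 * x 0 = k →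
      ∃ a ∈ A, ∃ y ∈ Z, ∀ l, (n : ℤ) * (a l - x l) = y l - x l := by
  classical
  rcases (Z.filter fun x => v 0 * x 1 - v 1 * x 0 = k).eq_empty_or_nonempty with hem | hne
  · refine ⟨∅, by simp, by simp, fun x hx hxk => ?_⟩
    exact absurd hxk ((Finset.filter_eq_empty_iff.1 hem) hx)
  obtain ⟨y₀, hy₀, hmin⟩ := Finset.exists_min_image _ (fun x => v 0 * x 0 + v 1 * x 1) hne
  obtain ⟨y₁, hy₁, hmax⟩ := Finset.exists_max_image _ (fun x => v 0 * x 0 + v 1 * x 1) hne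
  rw [Finset.mem_filter] at hy₀ hy₁
  have hvpos : 0 < v 0 * v 0 + v 1 * v 1 := by
    have : v 0 ≠ 0 ∨ v 1 ≠ 0 := by
      by_contra! h
      obtain ⟨a, b, hab⟩ := hv
      rw [h.1, h.2] at hab
      simp at hab
    rcases this with h | h
    · have := mul_self_pos.2 h; nlinarith [mul_self_nonneg (v 1)]
    · have := mul_self_pos.2 h; nlinarith [mul_self_nonneg (v 0)]
  have hpar : ∀ x ∈ Z, v 0 * x 1 - v 1 * x 0 = k → ∃ i : ℕ, ∀ l, x l = y₀ l + i * v l := by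
    intro x hx hxk
    obtain ⟨a, b, hab⟩ := hv
    set i : ℤ := a * (x 0 - y₀ 0) + b * (x 1 - y₀ 1) with hi
    have h0 : x 0 = y₀ 0 + i * v 0 := by
      linear_combination (-(x 0 - y₀ 0)) * hab - b * (hxk - hy₀.2) + v 0 * hi
    have h1 : x 1 = y₀ 1 + i * v 1 := by
      linear_combination (-(x 1 - y₀ 1)) * hab + a * (hxk - hy₀.2) + v 1 * hi
    have hipos : 0 ≤ i := by
      have := hmin x (Finset.mem_filter.2 ⟨hx, hxk⟩)
      rw [h0, h1] at this
      by_contra! hneg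
      nlinarith
    refine ⟨i.toNat, fun l => ?_⟩
    rw [Int.toNat_of_nonneg hipos]
    fin_cases l
    · exact h0
    · exact h1
  obtain ⟨M, hM⟩ := hpar y₁ hy₁.1 hy₁.2
  have hmem : ∀ i : ℕ, i ≤ M → (fun l => y₀ l + i * v l) ∈ Z := by
    intro i hi
    rw [hZ]
    rcases Nat.eq_zero_or_pos M with hM0 | hM0
    · obtain rfl : i = 0 := by omega
      simpa using (hZ _).1 hy₀.1
    have hMR : (0 : ℝ) < M := by exact_mod_cast hM0
    have hiR : (i : ℝ) ≤ M := by exact_mod_cast hi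
    refine mem_of_eq_combination_three hK ((hZ _).1 hy₀.1) ((hZ _).1 hy₁.1) ((hZ _).1 hy₁.1)
      (α := 1 - i / M) (β := i / M) (γ := 0) ?_ (by positivity) le_rfl (by ring) fun l => ?_
    · rw [sub_nonneg, div_le_one hMR]; exact hiR
    · simp only [latticeVec, hM l]
      push_cast
      field_simp
      ring
  obtain ⟨T, hTcard, hTM, hT⟩ := exists_hitting_set_interval M n hn
  refine ⟨T.image fun t : ℕ => fun l => y₀ l + t * v l, ?_, Finset.card_image_le.trans hTcard, ?_⟩
  · intro a ha
    obtain ⟨t, ht, rfl⟩ := Finset.mem_image.1 ha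
    exact hmem t (hTM t ht)
  · intro x hx hxk
    obtain ⟨i, hi⟩ := hpar x hx hxk
    have hiM : i ≤ M := by
      have := hmax x (Finset.mem_filter.2 ⟨hx, hxk⟩)
      rw [hi 0, hi 1, hM 0, hM 1] at this
      by_contra! hlt
      have : (M : ℤ) < i := by exact_mod_cast hlt
      nlinarith
    obtain ⟨t, ht, h1, h2⟩ := hT i hiM
    refine ⟨_, Finset.mem_image_of_mem _ ht, _, hmem (n * t + i - n * i) (by omega), fun l => ?_⟩
    rw [Nat.cast_sub h1, hi l]
    push_cast
    ring

/-- If `K` contains a lattice triangle whose base is `2 * n` times a primitive vector and whose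
lattice height is at least `2 * n`, then each copy of `K` scaled by `1 / n` contains a lattice
point. -/
theorem exists_lattice_point_of_triangle (K : Set (Fin 2 → ℝ)) (hK : Convex ℝ K) (n : ℕ)
    (hn : 0 < n) (v x y : Fin 2 → ℤ) (hv : IsCoprime (v 0) (v 1)) (hx : latticeVec x ∈ K)
    (hxv : latticeVec (fun l => x l + 2 * n * v l) ∈ K) (hy : latticeVec y ∈ K)
    (hH : 2 * (n : ℤ) ≤ |(v 0 * y 1 - v 1 * y 0) - (v 0 * x 1 - v 1 * x 0)|) (p : Fin 2 → ℝ) :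
    ∃ w : Fin 2 → ℤ, ∃ k ∈ K, ∀ l, (n : ℝ) * (w l - p l) = k l - p l := by
  have hnR : (0 : ℝ) < n := by exact_mod_cast hn
  set a : ℝ := v 0 * (p 1 + (x 1 - p 1) / n) - v 1 * (p 0 + (x 0 - p 0) / n) with ha
  set H : ℤ := (v 0 * y 1 - v 1 * y 0) - (v 0 * x 1 - v 1 * x 0) with hHdef
  have hHR : (H : ℝ) = (v 0 * y 1 - v 1 * y 0) - (v 0 * x 1 - v 1 * x 0) := by
    rw [hHdef]; push_cast; ring
  -- The shrunk triangle has lattice height at least `2`, so a lattice line crosses the half next to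
  -- its base.
  obtain ⟨k, s, hs0, hs1, hks⟩ : ∃ (k : ℤ) (s : ℝ), 0 ≤ s ∧ s ≤ 1 / 2 ∧ a + s * (H / n) = k := by
    rcases le_abs.1 hH with h | h
    · have hη : (2 : ℝ) ≤ H / n := by
        rw [le_div_iff₀ hnR]; exact_mod_cast h
      have h1 := Int.le_ceil a
      have h2 := Int.ceil_lt_add_one a
      refine ⟨⌈a⌉, (⌈a⌉ - a) / (H / n), div_nonneg (by linarith) (by linarith), ?_, ?_⟩
      · rw [div_le_iff₀ (by linarith)]; linarith
      · rw [div_mul_cancel₀ _ (by linarith)]; ring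
    · have hη : (2 : ℝ) ≤ -(H / n) := by
        rw [← neg_div, le_div_iff₀ hnR]; exact_mod_cast h
      have h1 := Int.floor_le a
      have h2 := Int.lt_floor_add_one a
      refine ⟨⌊a⌋, (a - ⌊a⌋) / (-(H / n)), div_nonneg (by linarith) (by linarith), ?_, ?_⟩
      · rw [div_le_iff₀ (by linarith)]; linarith
      · rw [div_neg, neg_mul, div_mul_cancel₀ _ (by linarith)]; ring
  obtain ⟨b₀, b₁, hb⟩ := hv
  have hbR : (b₀ * v 0 + b₁ * v 1 : ℝ) = 1 := by exact_mod_cast hb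
  let Q : Fin 2 → ℝ := fun l => p l + (x l - p l) / n + s * ((y l - x l) / n)
  have hQ : v 0 * Q 1 - v 1 * Q 0 = k := by
    rw [← hks, ha, hHR]
    simp only [Q]
    ring
  let w₀ : Fin 2 → ℤ := ![-b₁ * k, b₀ * k]
  let ρ : ℝ := b₀ * (Q 0 - w₀ 0) + b₁ * (Q 1 - w₀ 1)
  have hρ : ∀ l, Q l = w₀ l + ρ * v l := by
    have e0 : (w₀ 0 : ℝ) = -b₁ * k := by simp [w₀]
    have e1 : (w₀ 1 : ℝ) = b₀ * k := by simp [w₀]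
    have e2 : ρ = b₀ * (Q 0 + b₁ * k) + b₁ * (Q 1 - b₀ * k) := by
      simp only [ρ, e0, e1]; ring
    intro l
    fin_cases l
    · simp only [Fin.zero_eta, e0, e2]
      linear_combination (-Q 0) * hbR - b₁ * hQ
    · simp only [Fin.mk_one, e1, e2]
      linear_combination (-Q 1) * hbR + b₀ * hQ
  -- At relative height `s ≤ 1 / 2` the chord that starts at `Q` is `2 * (1 - s) ≥ 1` times `v`, so
  -- it contains the next lattice point.
  have hr0 := Int.le_ceil ρ
  have hr1 := Int.ceil_lt_add_one ρ
  refine ⟨fun l => w₀ l + ⌈ρ⌉ * v l,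
    fun l => p l + n * ((w₀ l + ⌈ρ⌉ * v l : ℝ) - p l), ?_, fun l => by push_cast; ring⟩
  refine mem_of_eq_combination_three hK hx hy hxv (α := 1 - s - (⌈ρ⌉ - ρ) / 2) (β := s)
    (γ := (⌈ρ⌉ - ρ) / 2) (by linarith) hs0 (by linarith) (by ring) fun l => ?_
  have e := hρ l
  have e' : n * Q l = n * p l + (x l - p l) + s * (y l - x l) := by
    simp only [Q]; field_simp
  simp only [latticeVec]
  push_cast
  linear_combination (-n : ℝ) * e + e'

/-- If some copy of `K` scaled by `1 / n` towards a point contains no lattice points, then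
`(4 * n + 1) ^ 2` lattice points of `K` suffice to meet all copies of `K` scaled by `1 / n` towards
its lattice points. -/
theorem exists_hitting_set (K : Set (Fin 2 → ℝ)) (hK : Convex ℝ K) (Z : Finset (Fin 2 → ℤ))
    (hZ : ∀ x, x ∈ Z ↔ latticeVec x ∈ K) (n : ℕ) (hn : 0 < n) (p : Fin 2 → ℝ)
    (hfree : ¬ ∃ w : Fin 2 → ℤ, ∃ k ∈ K, ∀ l, (n : ℝ) * (w l - p l) = k l - p l) :
    ∃ A ⊆ Z, A.card ≤ (4 * n + 1) ^ 2 ∧ ∀ x ∈ Z,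
      ∃ a ∈ A, ∃ y ∈ Z, ∀ l, (n : ℤ) * (a l - x l) = y l - x l := by
  classical
  by_cases hcard : Z.card ≤ (4 * n + 1) ^ 2
  · exact ⟨Z, subset_rfl, hcard, fun x hx => ⟨x, hx, x, hx, fun l => by simp⟩⟩
  have : NeZero (2 * n) := ⟨by omega⟩
  -- More than `(2 * n) ^ 2` points: two agree modulo `2 * n`, and their difference is a positive
  -- multiple of `2 * n` times a primitive vector `v`.
  obtain ⟨x, hx, x', hx', hne, hmod⟩ : ∃ x ∈ Z, ∃ x' ∈ Z, x ≠ x' ∧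
      (fun l => ((x l : ℤ) : ZMod (2 * n))) = fun l => ((x' l : ℤ) : ZMod (2 * n)) := by
    refine Finset.exists_ne_map_eq_of_card_lt_of_maps_to (t := Finset.univ)
      (f := fun (x : Fin 2 → ℤ) l => ((x l : ℤ) : ZMod (2 * n))) ?_ fun _ _ => Finset.mem_univ _
    simp only [Finset.card_univ, Fintype.card_fun, ZMod.card, Fintype.card_fin]
    nlinarith
  have hdvd : ∀ l, ∃ u, x' l - x l = 2 * n * u := by
    intro l
    have := congrFun hmod l
    rw [ZMod.intCast_eq_intCast_iff_dvd_sub] at this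
    obtain ⟨u, hu⟩ := this
    exact ⟨u, by push_cast at hu; exact hu⟩
  choose u hu using hdvd
  have hgcd : 0 < Int.gcd (u 0) (u 1) := by
    rw [Int.gcd_pos_iff]
    by_contra! h
    apply hne
    ext l
    have := hu l
    have hul : u l = 0 := by fin_cases l; exacts [h.1, h.2]
    rw [hul] at this
    linarith
  obtain ⟨v₀, v₁, hv, h0, h1⟩ := Int.exists_gcd_one hgcd
  set r := Int.gcd (u 0) (u 1)
  let v : Fin 2 → ℤ := ![v₀, v₁]
  have hvc : IsCoprime (v 0) (v 1) := Int.isCoprime_iff_gcd_eq_one.2 hv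
  have hx'v : ∀ l, x' l = x l + 2 * n * (v l * r) := by
    intro l
    have := hu l
    fin_cases l
    · simp only [Fin.zero_eta] at this ⊢
      rw [h0] at this
      simp only [v, Matrix.cons_val_zero]
      linarith
    · simp only [Fin.mk_one] at this ⊢
      rw [h1] at this
      simp only [v, Matrix.cons_val_one, Matrix.cons_val_zero]
      linarith
  have hrR : (1 : ℝ) ≤ r := by exact_mod_cast hgcd
  have hxv : latticeVec (fun l => x l + 2 * n * v l) ∈ K := by
    refine mem_of_eq_combination_three hK ((hZ _).1 hx) ((hZ _).1 hx') ((hZ _).1 hx')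
      (α := 1 - 1 / r) (β := 1 / r) (γ := 0) ?_ (by positivity) le_rfl (by ring) fun l => ?_
    · rw [sub_nonneg, div_le_one (by linarith)]; exact hrR
    · simp only [latticeVec, hx'v l]
      push_cast
      field_simp
      ring
  let a : (Fin 2 → ℤ) → ℤ := fun y => v 0 * y 1 - v 1 * y 0
  -- A higher point would span a triangle that forces a lattice point into the copy at `p`. Hence
  -- `Z` lies on at most `4 * n + 1` lattice lines.
  have hheight : ∀ y ∈ Z, |a y - a x| ≤ 2 * n := by
    intro y hy
    by_contra! hlt
    exact hfree (exists_lattice_point_of_triangle K hK n hn v x y hvc ((hZ _).1 hx) hxv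
      ((hZ _).1 hy) hlt.le p)
  choose A hAZ hAcard hA using exists_hitting_set_line K hK Z hZ n hn v hvc
  refine ⟨(Finset.Icc (a x - 2 * n) (a x + 2 * n)).biUnion A,
    Finset.biUnion_subset.2 fun k _ => hAZ k, ?_, fun y hy => ?_⟩
  · refine Finset.card_biUnion_le.trans ((Finset.sum_le_card_nsmul _ _ _
      fun k _ => hAcard k).trans (le_of_eq ?_))
    rw [Int.card_Icc, smul_eq_mul, sq]
    congr 1
    omega
  · obtain ⟨b, hb, z, hz, hbz⟩ := hA (a y) y hy rfl
    have := abs_le.1 (hheight y hy)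
    exact ⟨b, Finset.mem_biUnion.2 ⟨a y, Finset.mem_Icc.2 ⟨by linarith, by linarith⟩, hb⟩,
      z, hz, hbz⟩

/-! ### The cutting step -/

/-- A ray that starts in a compact set `K` has a farthest point in `K`. -/
theorem exists_ray_end {E : Type*} [NormedAddCommGroup E] [NormedSpace ℝ E] {K : Set E}
    (hK : IsCompact K) {c : E} (hc : c ∈ K) (v : E) :
    ∃ σ : ℝ, 0 ≤ σ ∧ c + σ • v ∈ K ∧
      ∀ r : ℝ, 0 ≤ r → c + r • v ∈ K → ∃ t ∈ Set.Icc (0 : ℝ) 1, r • v = t • σ • v := by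
  by_cases hv : v = 0
  · subst hv
    exact ⟨0, le_rfl, by simpa, fun r _ _ => ⟨0, by simp, by simp⟩⟩
  set T : Set ℝ := {r | 0 ≤ r ∧ c + r • v ∈ K} with hT
  have hcl : IsClosed T :=
    (isClosed_le continuous_const continuous_id).inter
      (hK.isClosed.preimage (by fun_prop : Continuous fun r : ℝ => c + r • v))
  have h0 : (0 : ℝ) ∈ T := ⟨le_rfl, by simpa⟩
  have hbdd : BddAbove T := by
    obtain ⟨M, hM⟩ := hK.isBounded.exists_norm_le
    have hvn : 0 < ‖v‖ := norm_pos_iff.2 hv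
    refine ⟨(M + ‖c‖) / ‖v‖, fun r hr => ?_⟩
    rw [le_div_iff₀ hvn]
    calc r * ‖v‖ = ‖r • v‖ := by rw [norm_smul, Real.norm_of_nonneg hr.1]
      _ = ‖(c + r • v) - c‖ := by rw [add_sub_cancel_left]
      _ ≤ ‖c + r • v‖ + ‖c‖ := norm_sub_le _ _
      _ ≤ M + ‖c‖ := by linarith [hM _ hr.2]
  have hmem := hcl.csSup_mem ⟨0, h0⟩ hbdd
  refine ⟨sSup T, hmem.1, hmem.2, fun r hr hrK => ?_⟩
  have hle : r ≤ sSup T := le_csSup hbdd ⟨hr, hrK⟩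
  refine ⟨r / sSup T, ⟨div_nonneg hr hmem.1, div_le_one_of_le₀ hle hmem.1⟩, ?_⟩
  rw [smul_smul]
  rcases hmem.1.eq_or_lt with h | h
  · have : r = 0 := by linarith
    simp [this]
  · rw [div_mul_cancel₀ _ h.ne']

/-- One cutting step for a nonempty set `R` of lattice points of a compact convex set `K`. Here `C`
stands for an unknown convex set around `p`. If the lattice point `c` lies outside `C`, then `C`
misses `R₁` in case it meets the segment from `c` to `c + e`, and it misses `R₂` otherwise. -/
theorem exists_cut (K : Set (Fin 2 → ℝ)) (hK : Convex ℝ K) (hKc : IsCompact K)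
    (Z : Finset (Fin 2 → ℤ)) (hZ : ∀ x, x ∈ Z ↔ latticeVec x ∈ K) (p : Fin 2 → ℝ)
    (hp : ∀ x, latticeVec x ≠ p) (R : Finset (Fin 2 → ℤ)) (hR : R ⊆ Z) (hne : R.Nonempty) :
    ∃ c ∈ Z, ∃ (e : Fin 2 → ℝ) (R₁ R₂ : Finset (Fin 2 → ℤ)), R₁ ⊆ R ∧ R₂ ⊆ R ∧
      R.card ≤ 16 * R₁.card ∧ R.card ≤ 16 * R₂.card ∧ latticeVec c + e ∈ K ∧
      (∀ x ∈ R₁, ∀ t ∈ Set.Icc (0 : ℝ) 1, ∀ C : Set (Fin 2 → ℝ), Convex ℝ C → p ∈ C →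
        latticeVec x ∈ C → latticeVec c + t • e ∈ C → latticeVec c ∈ C) ∧
      (∀ x ∈ R₂, ∀ C ⊆ K, Convex ℝ C → p ∈ C → latticeVec x ∈ C →
        ∃ t ∈ Set.Icc (0 : ℝ) 1, latticeVec c + t • e ∈ C) := by
  classical
  have hmid : ∀ x ∈ Z, ∀ y ∈ Z, ∀ w : Fin 2 → ℤ, (∀ j, 2 * w j = x j + y j) → w ∈ Z := by
    intro x hx y hy w hw
    rw [hZ] at hx hy ⊢
    refine mem_of_eq_combination_three hK hx hy hy (α := 1 / 2) (β := 1 / 2) (γ := 0)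
      (by norm_num) (by norm_num) le_rfl (by norm_num) fun l => ?_
    have : (2 * w l : ℝ) = x l + y l := by exact_mod_cast hw l
    simp only [latticeVec]
    linarith
  obtain ⟨c, hcZ, hc⟩ := exists_lattice_centerpoint Z R hR hne hmid
  have hu : p - latticeVec c ≠ 0 := sub_ne_zero.2 (hp c).symm
  obtain ⟨v, h1, h2⟩ := exists_balanced_direction R c _ hu (fun a₀ a₁ => by convert hc a₀ a₁)
  obtain ⟨σ, hσ, hσK, hray⟩ := exists_ray_end hKc ((hZ c).1 hcZ) v
  refine ⟨c, hcZ, σ • v, _, _, Finset.filter_subset _ _, Finset.filter_subset _ _, h1, h2, hσK,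
    ?_, ?_⟩
  · intro x hx t ht C hC hpC hxC htC
    obtain ⟨-, i, j, hi, hj, hx⟩ := Finset.mem_filter.1 hx
    rcases (mul_nonneg ht.1 hσ).eq_or_lt with h0 | h0
    · rwa [smul_smul, ← h0, zero_smul, add_zero] at htC
    · have hpos : 0 < 1 + i + j / (t * σ) := by positivity
      refine mem_of_eq_combination_three hC hxC hpC htC (α := 1 / (1 + i + j / (t * σ)))
        (β := i / (1 + i + j / (t * σ))) (γ := (j / (t * σ)) / (1 + i + j / (t * σ)))
        (by positivity) (by positivity) (by positivity) (by field_simp) fun l => ?_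
      have hxl := hx l
      have e : (j / (t * σ)) * (t * σ) = j := div_mul_cancel₀ _ h0.ne'
      rw [div_mul_eq_mul_div, div_mul_eq_mul_div, div_mul_eq_mul_div, ← add_div, ← add_div,
        eq_div_iff hpos.ne']
      simp only [latticeVec, Pi.add_apply, Pi.smul_apply, Pi.sub_apply, smul_eq_mul] at hxl ⊢
      linear_combination (-1 : ℝ) * hxl - v l * e
  · intro x hx C hCK hC hpC hxC
    obtain ⟨-, i, j, hi, hj, hx⟩ := Finset.mem_filter.1 hx
    have hpos : 0 < 1 + i := by linarith
    -- Here the segment from `x` to `p` crosses the ray.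
    have hmem : latticeVec c + (j / (1 + i)) • v ∈ C := by
      refine mem_of_eq_combination_three hC hxC hpC hpC (α := 1 / (1 + i)) (β := i / (1 + i))
        (γ := 0) (by positivity) (by positivity) le_rfl (by field_simp; ring) fun l => ?_
      have hxl := hx l
      simp only [latticeVec, Pi.add_apply, Pi.smul_apply, Pi.sub_apply, smul_eq_mul] at hxl ⊢
      field_simp
      linear_combination (-1 : ℝ) * hxl
    obtain ⟨t, ht, hte⟩ := hray _ (by positivity) (hCK hmem)
    exact ⟨t, ht, by rwa [← hte]⟩

/-! ### Section search on a segment -/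

/-- A section step of the search: if the value at `v` exceeds `m + 2 * γ` and up to `γ` the value
at `u`, then there is no value below `m` on the other side of `v`, not farther away from `v` than
`u`. -/
theorem lt_of_section {ψ : ℝ → ℝ} {s : Set ℝ} (hψ : ConvexOn ℝ s ψ) {u v t m γ : ℝ}
    (hγ : 0 ≤ γ) (hu : u ∈ s) (ht : t ∈ s) (huv : ψ u ≤ ψ v + γ) (hv : m + 2 * γ < ψ v) {r : ℝ}
    (hr0 : 0 ≤ r) (hr : r ≤ 1 / 2) (hvr : v = r * u + (1 - r) * t) : m < ψ t := by
  by_contra! hm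
  have h := hψ.2 hu ht hr0 (show 0 ≤ 1 - r by linarith) (by ring)
  simp only [smul_eq_mul, ← hvr] at h
  have h1 : r * ψ u ≤ r * (ψ v + γ) := mul_le_mul_of_nonneg_left huv hr0
  have h2 : (1 - r) * ψ t ≤ (1 - r) * m := mul_le_mul_of_nonneg_left hm (by linarith)
  have h3 : (1 / 2) * (ψ v - m + γ) ≤ (1 - r) * (ψ v - m + γ) :=
    mul_le_mul_of_nonneg_right (by linarith) (by linarith)
  nlinarith

/-- A convex function on `[0, 1]` of spread at most `V` with values above `m + 2 * γ` at the ends of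
a short subinterval is above `m` on the subinterval. -/
theorem lt_of_short_interval {ψ : ℝ → ℝ} (hψ : ConvexOn ℝ (Set.Icc 0 1) ψ) {V m γ lo hi t : ℝ}
    (hV : ∀ s ∈ Set.Icc (0 : ℝ) 1, ∀ t ∈ Set.Icc (0 : ℝ) 1, ψ s - ψ t ≤ V)
    (h0 : 0 ≤ lo) (h1 : hi ≤ 1) (hlo : m + 2 * γ < ψ lo) (hhi : m + 2 * γ < ψ hi)
    (hs : (hi - lo) * V ≤ 2 * γ) (hlt : lo ≤ t) (hth : t ≤ hi) : m < ψ t := by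
  by_contra! hm
  have ht : t ∈ Set.Icc (0 : ℝ) 1 := ⟨by linarith, by linarith⟩
  have hVpos : 0 ≤ V := by simpa using hV t ht t ht
  have key : ∀ e ∈ Set.Icc (0 : ℝ) 1, ∀ r, 0 ≤ r → r ≤ hi - lo →
      ψ ((1 - r) * t + r * e) ≤ m + 2 * γ := by
    intro e he r hr0 hr
    have h := hψ.2 ht he (show 0 ≤ 1 - r by linarith) hr0 (by ring)
    simp only [smul_eq_mul] at h
    have h2 : r * (ψ e - ψ t) ≤ r * V := mul_le_mul_of_nonneg_left (hV e he t ht) hr0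
    have h3 : r * V ≤ (hi - lo) * V := mul_le_mul_of_nonneg_right hr hVpos
    linarith
  -- The two bounds `(hi - lo) * (1 - t)` and `(hi - lo) * t` add up to `hi - lo`, so `hi` or `lo`
  -- arises from `t` by a step of relative size at most `hi - lo` towards `1` or `0`.
  by_cases hc : hi - t ≤ (hi - lo) * (1 - t)
  · rcases ht.2.eq_or_lt with h | h
    · have : t = hi := by linarith
      have := key t ht 0 le_rfl (by linarith)
      have e : (1 - 0) * t + 0 * t = hi := by linarith
      rw [e] at this
      linarith
    · have := key 1 (by simp) ((hi - t) / (1 - t)) (div_nonneg (by linarith) (by linarith))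
        ((div_le_iff₀ (by linarith)).2 hc)
      have e : (1 - (hi - t) / (1 - t)) * t + (hi - t) / (1 - t) * 1 = hi := by
        have : 1 - t ≠ 0 := by linarith
        field_simp
        ring
      rw [e] at this
      linarith
  · have hc' : t - lo ≤ (hi - lo) * t := by linarith
    rcases ht.1.eq_or_lt with h | h
    · have := key t ht 0 le_rfl (by linarith)
      have e : (1 - 0) * t + 0 * t = lo := by linarith
      rw [e] at this
      linarith
    · have := key 0 (by simp) ((t - lo) / t) (div_nonneg (by linarith) h.le)
        ((div_le_iff₀ h).2 hc')
      have e : (1 - (t - lo) / t) * t + (t - lo) / t * 0 = lo := by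
        field_simp
        ring
      rw [e] at this
      linarith

namespace QueryAlgorithm

variable {d : ℕ}

/-- Ask for `y_x` and then for the value `f (x, y_x)`. -/
noncomputable def probe (x : Fin 2 → ℝ) (next : (Fin d → ℝ) → ℝ → QueryAlgorithm 2 d) :
    QueryAlgorithm 2 d :=
  minimize x fun y => evaluate (x, y) fun t => next y t.toReal

/-- Section search along the path `q` between the parameters `lo` and `hi`. It goes on with `true`
as soon as it has found a value at most `thr`, and with `false` after `k` sections. -/
noncomputable def sectionSearch (thr : ℝ) (q : ℝ → Fin 2 → ℝ) (next : Bool → QueryAlgorithm 2 d) :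
    ℕ → ℝ → ℝ → QueryAlgorithm 2 d
  | 0, _, _ => next false
  | k + 1, lo, hi =>
    probe (q (lo + (hi - lo) / 3)) fun _ a =>
      if a ≤ thr then next true else
        probe (q (hi - (hi - lo) / 3)) fun _ b =>
          if b ≤ thr then next true else
            if a ≤ b then sectionSearch thr q next k lo (hi - (hi - lo) / 3)
            else sectionSearch thr q next k (lo + (hi - lo) / 3) hi

/-- The invariant is `ψ > L + γ` outside `[lo, hi]` and `ψ > L + 3 * γ` at both ends. A probed value
above `L + 4 * γ` gives `ψ > L + 3 * γ`, and the margin `2 * γ` above `L + γ` pays for comparing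
inexact values and for stopping at a short interval. The conclusions for the two outcomes overlap.
-/
theorem sectionSearch_spec (f : Point 2 d → ℝ≥0∞) (ymin : (Fin 2 → ℝ) → (Fin d → ℝ))
    (q : ℝ → Fin 2 → ℝ) (ψ : ℝ → ℝ) (hψ : ConvexOn ℝ (Set.Icc 0 1) ψ) {L V γ : ℝ} (hγ : 0 < γ)
    (hf : ∀ t ∈ Set.Icc (0 : ℝ) 1, ψ t ≤ (f (q t, ymin (q t))).toReal ∧
      (f (q t, ymin (q t))).toReal ≤ ψ t + γ)
    (hV : ∀ s ∈ Set.Icc (0 : ℝ) 1, ∀ t ∈ Set.Icc (0 : ℝ) 1, ψ s - ψ t ≤ V)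
    (next : Bool → QueryAlgorithm 2 d) (k : ℕ) (lo hi : ℝ) (h0 : 0 ≤ lo) (hlh : lo ≤ hi)
    (h1 : hi ≤ 1) (hlo : L + 3 * γ < ψ lo) (hhi : L + 3 * γ < ψ hi)
    (hout : ∀ t ∈ Set.Icc (0 : ℝ) 1, t < lo ∨ hi < t → L + γ < ψ t)
    (hk : (2 / 3) ^ k * (hi - lo) * V ≤ 2 * γ) :
    ∃ b, output f ymin (sectionSearch (L + 4 * γ) q next k lo hi) = output f ymin (next b) ∧
      evaluations f ymin (sectionSearch (L + 4 * γ) q next k lo hi) ≤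
        evaluations f ymin (next b) + 2 * k ∧
      minimizations f ymin (sectionSearch (L + 4 * γ) q next k lo hi) ≤
        minimizations f ymin (next b) + 2 * k ∧
      (b = true → ∃ t ∈ Set.Icc (0 : ℝ) 1, ψ t ≤ L + 4 * γ) ∧
      (b = false → ∀ t ∈ Set.Icc (0 : ℝ) 1, L + γ < ψ t) := by
  induction k generalizing lo hi with
  | zero =>
    refine ⟨false, rfl, le_rfl, le_rfl, by simp, fun _ t ht => ?_⟩
    by_cases htt : t < lo ∨ hi < t
    · exact hout t ht htt
    · push Not at htt
      exact lt_of_short_interval (γ := γ) hψ hV h0 h1 (by linarith) (by linarith) (by simpa using hk)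
        htt.1 htt.2
  | succ k ih =>
    have hu : lo + (hi - lo) / 3 ∈ Set.Icc (0 : ℝ) 1 := ⟨by linarith, by linarith⟩
    have hv : hi - (hi - lo) / 3 ∈ Set.Icc (0 : ℝ) 1 := ⟨by linarith, by linarith⟩
    set u := lo + (hi - lo) / 3 with hudef
    set v := hi - (hi - lo) / 3 with hvdef
    simp only [sectionSearch, ← hudef, ← hvdef]
    obtain ⟨hu1, hu2⟩ := hf u hu
    obtain ⟨hv1, hv2⟩ := hf v hv
    simp only [probe, output, evaluations, minimizations]
    by_cases ha : (f (q u, ymin (q u))).toReal ≤ L + 4 * γ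
    · simp only [if_pos ha]
      exact ⟨true, rfl, by omega, by omega, fun _ => ⟨u, hu, by linarith⟩, by simp⟩
    simp only [if_neg ha, output, evaluations, minimizations]
    by_cases hb : (f (q v, ymin (q v))).toReal ≤ L + 4 * γ
    · simp only [if_pos hb]
      exact ⟨true, rfl, by omega, by omega, fun _ => ⟨v, hv, by linarith⟩, by simp⟩
    simp only [if_neg hb]
    by_cases hab : (f (q u, ymin (q u))).toReal ≤ (f (q v, ymin (q v))).toReal
    · simp only [if_pos hab]
      obtain ⟨r, e1, e2, e3, e4, e5⟩ := ih lo v h0 (by linarith) hv.2 hlo (by linarith) (by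
          intro t ht htt
          by_cases ht' : t < lo ∨ hi < t
          · exact hout t ht ht'
          · push Not at ht'
            have hvt : v < t := by
              rcases htt with h | h
              · exact absurd h (not_lt.2 ht'.1)
              · exact h
            have hut : 0 < t - u := by linarith
            -- The discarded third is as long as the middle one, whence `r ≤ 1 / 2`.
            refine lt_of_section (v := v) hψ hγ.le hu ht (by linarith) (by linarith)
              (r := (t - v) / (t - u)) (div_nonneg (by linarith) hut.le) ?_ ?_
            · rw [div_le_iff₀ hut]; linarith
            · field_simp; ring) (by
          have : (2 / 3 : ℝ) ^ (k + 1) * (hi - lo) * V = (2 / 3) ^ k * (v - lo) * V := by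
            rw [hvdef]; ring
          linarith)
      exact ⟨r, e1, by omega, by omega, e4, e5⟩
    · simp only [if_neg hab]
      obtain ⟨r, e1, e2, e3, e4, e5⟩ := ih u hi hu.1 (by linarith) h1 (by linarith) hhi (by
          intro t ht htt
          by_cases ht' : t < lo ∨ hi < t
          · exact hout t ht ht'
          · push Not at ht'
            have htu : t < u := by
              rcases htt with h | h
              · exact h
              · exact absurd h (not_lt.2 ht'.2)
            have htv : 0 < v - t := by linarith
            refine lt_of_section (v := u) hψ hγ.le hv ht (by linarith) (by linarith)
              (r := (u - t) / (v - t)) (div_nonneg (by linarith) htv.le) ?_ ?_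
            · rw [div_le_iff₀ htv]; linarith
            · field_simp; ring) (by
          have : (2 / 3 : ℝ) ^ (k + 1) * (hi - lo) * V = (2 / 3) ^ k * (hi - u) * V := by
            rw [hudef]; ring
          linarith)
      exact ⟨r, e1, by omega, by omega, e4, e5⟩

/-! ### Search among lattice points -/

/-- The search among the lattice points in `R`: probe the lattice point `ctr R`; if its value is
larger than `L + 5 * γ`, then search the segment from `ctr R` to `ctr R + e R` for a value at most
`L + 4 * γ`, and go on without `R₁ R` or `R₂ R` according to the outcome. -/
noncomputable def latticeSearch (L γ : ℝ) (k : ℕ) (ctr : Finset (Fin 2 → ℤ) → Fin 2 → ℤ)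
    (e : Finset (Fin 2 → ℤ) → Fin 2 → ℝ)
    (R₁ R₂ : Finset (Fin 2 → ℤ) → Finset (Fin 2 → ℤ)) :
    ℕ → Finset (Fin 2 → ℤ) → QueryAlgorithm 2 d
  | 0, _ => halt .noPoint
  | T + 1, R =>
    if R = ∅ then halt .noPoint else
      probe (latticeVec (ctr R)) fun y t =>
        if t ≤ L + 5 * γ then halt (.point (latticeVec (ctr R), y)) else
          probe (latticeVec (ctr R) + (1 : ℝ) • e R) fun _ t' =>
            if t' ≤ L + 4 * γ then latticeSearch L γ k ctr e R₁ R₂ T (R \ R₁ R) else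
              sectionSearch (L + 4 * γ) (fun s => latticeVec (ctr R) + s • e R)
                (fun b => latticeSearch L γ k ctr e R₁ R₂ T (R \ if b then R₁ R else R₂ R)) k 0 1

/-- Candidates are dropped only when `φ > L + γ` is certain for them. A probed value above `L + 5 *
γ` puts the center outside `{φ ≤ L + 4 * γ}`. If the segment meets this set, the set misses `R₁ R`;
if the segment avoids `{φ ≤ L + γ}`, that set misses `R₂ R`. Each round keeps at most `15 / 16` of
the candidates, so none is left when the rounds run out. -/
theorem latticeSearch_spec (f : Point 2 d → ℝ≥0∞) (ymin : (Fin 2 → ℝ) → (Fin d → ℝ))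
    {K : Set (Fin 2 → ℝ)} {φ : (Fin 2 → ℝ) → ℝ} (hφ : ConvexOn ℝ K φ) {L V γ : ℝ} (hγ : 0 < γ)
    (hf : ∀ x ∈ K, φ x ≤ (f (x, ymin x)).toReal ∧ (f (x, ymin x)).toReal ≤ φ x + γ)
    (hV : ∀ x ∈ K, ∀ y ∈ K, φ x - φ y ≤ V) {p : Fin 2 → ℝ} (hp : p ∈ K) (hpL : φ p ≤ L)
    {Z A : Finset (Fin 2 → ℤ)} (hZ : ∀ x ∈ Z, latticeVec x ∈ K) (hAZ : A ⊆ Z)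
    {k : ℕ} (hk : (2 / 3) ^ k * V ≤ 2 * γ)
    {ctr : Finset (Fin 2 → ℤ) → Fin 2 → ℤ} {e : Finset (Fin 2 → ℤ) → Fin 2 → ℝ}
    {R₁ R₂ : Finset (Fin 2 → ℤ) → Finset (Fin 2 → ℤ)}
    (hcut : ∀ R, R ⊆ Z → R.Nonempty → ctr R ∈ Z ∧ R₁ R ⊆ R ∧ R₂ R ⊆ R ∧
      R.card ≤ 16 * (R₁ R).card ∧ R.card ≤ 16 * (R₂ R).card ∧ latticeVec (ctr R) + e R ∈ K ∧
      (∀ x ∈ R₁ R, ∀ t ∈ Set.Icc (0 : ℝ) 1, ∀ C : Set (Fin 2 → ℝ), Convex ℝ C → p ∈ C →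
        latticeVec x ∈ C → latticeVec (ctr R) + t • e R ∈ C → latticeVec (ctr R) ∈ C) ∧
      (∀ x ∈ R₂ R, ∀ C ⊆ K, Convex ℝ C → p ∈ C → latticeVec x ∈ C →
        ∃ t ∈ Set.Icc (0 : ℝ) 1, latticeVec (ctr R) + t • e R ∈ C))
    {P : OracleReport 2 d → Prop}
    (hpoint : ∀ c ∈ Z, (f (latticeVec c, ymin (latticeVec c))).toReal ≤ L + 5 * γ →
      P (.point (latticeVec c, ymin (latticeVec c))))
    (hno : (∀ a ∈ A, L + γ < φ (latticeVec a)) → P .noPoint)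
    (T : ℕ) (R : Finset (Fin 2 → ℤ)) (hRA : R ⊆ A)
    (hR : ∀ a ∈ A, a ∉ R → L + γ < φ (latticeVec a)) (hT : R.card * 15 ^ T < 16 ^ T) :
    P (output f ymin (latticeSearch L γ k ctr e R₁ R₂ T R)) ∧
      evaluations f ymin (latticeSearch L γ k ctr e R₁ R₂ T R) ≤ T * (2 * k + 2) ∧
      minimizations f ymin (latticeSearch L γ k ctr e R₁ R₂ T R) ≤ T * (2 * k + 2) := by
  induction T generalizing R with
  | zero =>
    have : R = ∅ := by
      rw [← Finset.card_eq_zero]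
      simpa using hT
    subst this
    exact ⟨hno fun a ha => hR a ha (by simp), by simp [latticeSearch, evaluations],
      by simp [latticeSearch, minimizations]⟩
  | succ T ih =>
    by_cases hRe : R = ∅
    · simp only [latticeSearch, if_pos hRe]
      subst hRe
      exact ⟨hno fun a ha => hR a ha (by simp), by simp [evaluations], by simp [minimizations]⟩
    obtain ⟨hc, hR₁, hR₂, hcard₁, hcard₂, heK, hcut₁, hcut₂⟩ :=
      hcut R (hRA.trans hAZ) (Finset.nonempty_iff_ne_empty.2 hRe)
    have hcK := hZ _ hc
    simp only [latticeSearch, if_neg hRe, probe, output, evaluations, minimizations]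
    set c := latticeVec (ctr R) with hcdef
    obtain ⟨hc1, hc2⟩ := hf c hcK
    by_cases hct : (f (c, ymin c)).toReal ≤ L + 5 * γ
    · simp only [if_pos hct, output, evaluations, minimizations]
      exact ⟨hpoint _ hc hct, by nlinarith, by nlinarith⟩
    simp only [if_neg hct, output, evaluations, minimizations]
    have hφc : L + 4 * γ < φ c := by linarith
    have hseg : ∀ t ∈ Set.Icc (0 : ℝ) 1, c + t • e R ∈ K := fun t ht =>
      hφ.1.add_smul_mem hcK heK ht
    have hlow : (∃ t ∈ Set.Icc (0 : ℝ) 1, φ (c + t • e R) ≤ L + 4 * γ) →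
        ∀ x ∈ R₁ R, L + γ < φ (latticeVec x) := by
      rintro ⟨t, ht, hφt⟩ x hx
      by_contra! hle
      have hxK : latticeVec x ∈ K := hZ _ (hAZ (hRA (hR₁ hx)))
      have := hcut₁ x hx t ht _ (hφ.convex_le (L + 4 * γ)) ⟨hp, by linarith⟩
        ⟨hxK, by linarith⟩ ⟨hseg t ht, hφt⟩
      linarith [this.2]
    have hhigh : (∀ t ∈ Set.Icc (0 : ℝ) 1, L + γ < φ (c + t • e R)) →
        ∀ x ∈ R₂ R, L + γ < φ (latticeVec x) := by
      intro hall x hx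
      by_contra! hle
      have hxK : latticeVec x ∈ K := hZ _ (hAZ (hRA (hR₂ hx)))
      obtain ⟨t, ht, -, hφt⟩ := hcut₂ x hx _ (Set.sep_subset _ _) (hφ.convex_le (L + γ))
        ⟨hp, by linarith⟩ ⟨hxK, hle⟩
      exact absurd (hall t ht) (not_lt.2 hφt)
    have hrec : ∀ Q ⊆ R, R.card ≤ 16 * Q.card → (∀ x ∈ Q, L + γ < φ (latticeVec x)) →
        P (output f ymin (latticeSearch L γ k ctr e R₁ R₂ T (R \ Q))) ∧
        evaluations f ymin (latticeSearch L γ k ctr e R₁ R₂ T (R \ Q)) ≤ T * (2 * k + 2) ∧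
        minimizations f ymin (latticeSearch L γ k ctr e R₁ R₂ T (R \ Q)) ≤ T * (2 * k + 2) := by
      intro Q hQR hQ hφQ
      refine ih _ (Finset.sdiff_subset.trans hRA) (fun a ha haR => ?_) ?_
      · by_cases haQ : a ∈ Q
        · exact hφQ a haQ
        · exact hR a ha fun h => haR (Finset.mem_sdiff.2 ⟨h, haQ⟩)
      · have h1 := Finset.card_sdiff_add_card_eq_card hQR
        have h2 : 16 * (R \ Q).card ≤ 15 * R.card := by omega
        have h3 := Nat.mul_le_mul_right (15 ^ T) h2
        rw [pow_succ, pow_succ] at hT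
        nlinarith
    have hadd : (T + 1) * (2 * k + 2) = T * (2 * k + 2) + 2 * k + 2 := by ring
    have h1mem : (1 : ℝ) ∈ Set.Icc (0 : ℝ) 1 := by simp
    obtain ⟨he1, he2⟩ := hf _ (hseg 1 h1mem)
    -- The far end is probed separately so that the section search starts with both ends above `L +
    -- 3 * γ`.
    by_cases hend : (f (c + (1 : ℝ) • e R, ymin (c + (1 : ℝ) • e R))).toReal ≤ L + 4 * γ
    · simp only [if_pos hend]
      obtain ⟨g1, g2, g3⟩ := hrec _ hR₁ hcard₁ (hlow ⟨1, h1mem, by linarith⟩)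
      exact ⟨g1, by omega, by omega⟩
    simp only [if_neg hend]
    have hψ : ConvexOn ℝ (Set.Icc 0 1) fun t : ℝ => φ (c + t • e R) := by
      refine ⟨convex_Icc _ _, fun s hs t ht a b ha hb hab => ?_⟩
      have := hφ.2 (hseg s hs) (hseg t ht) ha hb hab
      convert this using 2
      have hb' : b = 1 - a := by linarith
      subst hb'
      module
    obtain ⟨b, g1, g2, g3, g4, g5⟩ := sectionSearch_spec f ymin (fun s => c + s • e R) _ hψ hγ
      (L := L) (fun t ht => hf _ (hseg t ht)) (fun s hs t ht => hV _ (hseg s hs) _ (hseg t ht))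
      (fun b => latticeSearch L γ k ctr e R₁ R₂ T (R \ if b then R₁ R else R₂ R)) k 0 1 le_rfl
      zero_le_one le_rfl (by simp only [zero_smul, add_zero]; linarith) (by linarith)
      (fun t ht h => by
        rcases h with h | h
        · exact absurd ht.1 (not_le.2 h)
        · exact absurd ht.2 (not_le.2 h))
      (by simpa using hk)
    rw [g1]
    cases b
    · obtain ⟨k1, k2, k3⟩ := hrec _ hR₂ hcard₂ (hhigh (g5 rfl))
      simp only [Bool.false_eq_true, if_false] at g2 g3 ⊢
      exact ⟨k1, by omega, by omega⟩
    · obtain ⟨k1, k2, k3⟩ := hrec _ hR₁ hcard₁ (hlow (g4 rfl))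
      simp only [if_true] at g2 g3 ⊢
      exact ⟨k1, by omega, by omega⟩

end QueryAlgorithm

/-! ### The partial minimum as a finite convex function -/

theorem convex_feasibleSet {n d m : ℕ} {g : Fin m → Point n d → ℝ}
    (hg : ∀ i, ConvexOn ℝ Set.univ (g i)) : Convex ℝ (feasibleSet g) := by
  have : feasibleSet g = ⋂ i, {z | z ∈ Set.univ ∧ g i z ≤ 0} := by
    ext z; simp [feasibleSet]
  rw [this]
  exact convex_iInter fun i => (hg i).convex_le 0

/-- This makes the guarantee for `ymin` available over the whole projection of `S`. The attained
minimum supplies the lower bound that the real infimum needs. -/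
theorem partialConstraint_nonpos {n d m : ℕ} {g : Fin m → Point n d → ℝ} {x : Fin n → ℝ}
    (hmin : ∃ y : Fin d → ℝ, IsMinOn (fun y' => maxConstraint g (x, y')) Set.univ y)
    {y : Fin d → ℝ} (hy : (x, y) ∈ feasibleSet g) : partialConstraint g x ≤ 0 := by
  obtain ⟨y₀, hy₀⟩ := hmin
  have hbdd : BddBelow (Set.range fun y => maxConstraint g (x, y)) :=
    ⟨maxConstraint g (x, y₀), by rintro _ ⟨y', rfl⟩; exact hy₀ (Set.mem_univ y')⟩
  exact (ciInf_le hbdd y).trans (Real.iSup_nonpos hy)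

section partialMin

variable {n d : ℕ} {S : Set (Point n d)} {f : Point n d → ℝ≥0∞}

theorem toReal_convex (hf : ConvexOn ℝ≥0 Set.univ f) (hfin : ∀ z ∈ S, f z < ⊤) {z w : Point n d}
    (hz : z ∈ S) (hw : w ∈ S) {a b : ℝ} (ha : 0 ≤ a) (hb : 0 ≤ b) (hab : a + b = 1) :
    (f (a • z + b • w)).toReal ≤ a * (f z).toReal + b * (f w).toReal := by
  lift a to ℝ≥0 using ha
  lift b to ℝ≥0 using hb
  have h := hf.2 (Set.mem_univ z) (Set.mem_univ w) zero_le zero_le (by exact_mod_cast hab)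
  have h1 : (a : ℝ≥0∞) * f z ≠ ⊤ := ENNReal.mul_ne_top ENNReal.coe_ne_top (hfin z hz).ne
  have h2 : (b : ℝ≥0∞) * f w ≠ ⊤ := ENNReal.mul_ne_top ENNReal.coe_ne_top (hfin w hw).ne
  have h3 := ENNReal.toReal_mono (ENNReal.add_ne_top.2 ⟨h1, h2⟩) h
  rw [ENNReal.toReal_add h1 h2,
    ENNReal.toReal_mul, ENNReal.toReal_mul] at h3
  exact h3

theorem partialMin_lt_top (hfin : ∀ z ∈ S, f z < ⊤) {x : Fin n → ℝ} {y : Fin d → ℝ}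
    (hxy : (x, y) ∈ S) : partialMin S f x < ⊤ :=
  (iInf₂_le y hxy).trans_lt (hfin _ hxy)

theorem toReal_partialMin_le (hfin : ∀ z ∈ S, f z < ⊤) {x : Fin n → ℝ} {y : Fin d → ℝ}
    (hxy : (x, y) ∈ S) : (partialMin S f x).toReal ≤ (f (x, y)).toReal :=
  ENNReal.toReal_mono (hfin _ hxy).ne (iInf₂_le y hxy)

theorem exists_toReal_le_partialMin_add (hfin : ∀ z ∈ S, f z < ⊤) {x : Fin n → ℝ}
    (hx : ∃ y, (x, y) ∈ S) {ε : ℝ} (hε : 0 < ε) :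
    ∃ y, (x, y) ∈ S ∧ (f (x, y)).toReal ≤ (partialMin S f x).toReal + ε := by
  obtain ⟨y₀, hy₀⟩ := hx
  have hlt := (partialMin_lt_top hfin hy₀).ne
  have h : partialMin S f x < partialMin S f x + ENNReal.ofReal ε :=
    ENNReal.lt_add_right hlt (by simpa using hε)
  conv_lhs at h => unfold partialMin
  obtain ⟨y, hy⟩ := iInf_lt_iff.1 h
  obtain ⟨hyS, hy⟩ := iInf_lt_iff.1 hy
  refine ⟨y, hyS, ?_⟩
  have := ENNReal.toReal_mono (ENNReal.add_ne_top.2 ⟨hlt, ENNReal.ofReal_ne_top⟩) hy.le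
  rwa [ENNReal.toReal_add hlt ENNReal.ofReal_ne_top, ENNReal.toReal_ofReal hε.le] at this

/-- The infimum over `y` need not be attained, so `ε`-optimal points over `x` and `x'` are combined.
-/
theorem convexOn_toReal_partialMin (hS : Convex ℝ S) (hf : ConvexOn ℝ≥0 Set.univ f)
    (hfin : ∀ z ∈ S, f z < ⊤) :
    ConvexOn ℝ {x | ∃ y, (x, y) ∈ S} fun x => (partialMin S f x).toReal := by
  refine ⟨?_, ?_⟩
  · rintro x ⟨y, hy⟩ x' ⟨y', hy'⟩ a b ha hb hab
    exact ⟨a • y + b • y', hS hy hy' ha hb hab⟩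
  · intro x hx x' hx' a b ha hb hab
    refine le_of_forall_pos_le_add fun ε hε => ?_
    obtain ⟨y, hy, hy1⟩ := exists_toReal_le_partialMin_add hfin hx hε
    obtain ⟨y', hy', hy1'⟩ := exists_toReal_le_partialMin_add hfin hx' hε
    have h1 := toReal_partialMin_le (x := a • x + b • x') (y := a • y + b • y') hfin
      (hS hy hy' ha hb hab)
    have h2 := toReal_convex hf hfin hy hy' ha hb hab
    have h3 := mul_le_mul_of_nonneg_left hy1 ha
    have h4 := mul_le_mul_of_nonneg_left hy1' hb
    have h5 : a * ε + b * ε = ε := by rw [← add_mul, hab, one_mul]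
    have h6 : a • (x, y) + b • (x', y') = (a • x + b • x', a • y + b • y') := rfl
    rw [h6] at h2
    simp only [smul_eq_mul]
    linarith

theorem toReal_partialMin_sub_le (hfin : ∀ z ∈ S, f z < ⊤) {V : ℝ}
    (hV : ∀ z ∈ S, ∀ w ∈ S, (f z).toReal - (f w).toReal ≤ V) {x x' : Fin n → ℝ}
    (hx : ∃ y, (x, y) ∈ S) (hx' : ∃ y, (x', y) ∈ S) :
    (partialMin S f x).toReal - (partialMin S f x').toReal ≤ V := by
  refine le_of_forall_pos_le_add fun ε hε => ?_
  obtain ⟨y, hy⟩ := hx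
  obtain ⟨y', hy', hy1'⟩ := exists_toReal_le_partialMin_add hfin hx' hε
  have := hV _ hy _ hy'
  have := toReal_partialMin_le hfin hy
  linarith

end partialMin

/-! ### Assembly of the oracle -/

/-- The total loss is `5 * γ`: `γ` for the contraction, `2 * γ` for the section search, and `γ` each
for the inexact values on the segment and at the center. -/
theorem five_le_kappa : 5 ≤ kappa := by
  have h5 : √5 ^ 2 = 5 := Real.sq_sqrt (by norm_num)
  have h0 : 0 ≤ √5 := Real.sqrt_nonneg 5
  have h1 : 2 ≤ √5 := Real.le_sqrt_of_sq_le (by norm_num)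
  rw [kappa, le_div_iff₀ lambda0_spec.1, lambda0]
  nlinarith

/-- A feasible lattice point whose value exceeds `f z` by at most `5 * γ` may be returned. -/
theorem isImproving_of_toReal_le {n d : ℕ} {S : Set (Point n d)} {f : Point n d → ℝ≥0∞}
    (hfin : ∀ z ∈ S, f z < ⊤) {γ : ℝ} (hγ : 0 < γ) {z w : Point n d} (hz : z ∈ S) (hw : w ∈ S)
    (hlat : w ∈ mixedLattice n d) (h : (f w).toReal ≤ (f z).toReal + 5 * γ) :
    IsImproving 0 (ENNReal.ofReal (kappa * γ)) S f z w := by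
  refine ⟨⟨hw, hlat⟩, ?_⟩
  have hκ : 5 * γ ≤ kappa * γ := mul_le_mul_of_nonneg_right five_le_kappa hγ.le
  rw [add_zero, one_mul, ← ENNReal.toReal_le_toReal (hfin w hw).ne
    (ENNReal.add_ne_top.2 ⟨(hfin z hz).ne, ENNReal.ofReal_ne_top⟩),
    ENNReal.toReal_add (hfin z hz).ne ENNReal.ofReal_ne_top,
    ENNReal.toReal_ofReal (by linarith)]
  linarith

/-- Moving a point towards another one by the fraction `1 / n` raises a convex function of spread
at most `V ≤ n * γ` by at most `γ`. -/
theorem le_add_of_contraction {K : Set (Fin 2 → ℝ)} {φ : (Fin 2 → ℝ) → ℝ} (hφ : ConvexOn ℝ K φ)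
    {V γ L : ℝ} (hV : ∀ x ∈ K, ∀ y ∈ K, φ x - φ y ≤ V) {n : ℕ} (hn : 0 < n) (hnV : V ≤ n * γ)
    {x y w : Fin 2 → ℝ} (hx : x ∈ K) (hy : y ∈ K) (hxL : φ x ≤ L)
    (hw : ∀ l, (n : ℝ) * (w l - x l) = y l - x l) : w ∈ K ∧ φ w ≤ L + γ := by
  have hnR : (0 : ℝ) < n := by exact_mod_cast hn
  have hn1 : (1 : ℝ) ≤ n := by exact_mod_cast hn
  have ha : (0 : ℝ) ≤ 1 - 1 / n := by
    rw [sub_nonneg, div_le_one hnR]; exact hn1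
  have hb : (0 : ℝ) ≤ 1 / n := by positivity
  have hwe : w = (1 - 1 / n : ℝ) • x + (1 / n : ℝ) • y := by
    ext l
    simp only [Pi.add_apply, Pi.smul_apply, smul_eq_mul]
    have := hw l
    field_simp
    linarith
  have h := hφ.2 hx hy ha hb (by ring)
  refine ⟨hwe ▸ hφ.1 hx hy ha hb (by ring), ?_⟩
  rw [← hwe] at h
  simp only [smul_eq_mul] at h
  have h1 : 1 / n * (φ y - φ x) ≤ 1 / n * (n * γ) :=
    mul_le_mul_of_nonneg_left ((hV y hy x hx).trans hnV) hb
  have h2 : 1 / n * (n * γ) = γ := by field_simp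
  linarith

/-- The improvement oracle at one point, with its cost in terms of a number `ℓ` with
`V / γ ≤ n ≤ 2 ^ ℓ`. -/
theorem exists_oracle_at {d m B : ℕ} {g : Fin m → Point 2 d → ℝ} {V γ : ℝ} (hγ : 0 < γ)
    (hg : ∀ i, ConvexOn ℝ Set.univ (g i))
    (hB : ∀ z ∈ feasibleSet g, ∀ i, |z.1 i| ≤ (B : ℝ))
    (hmin : ∀ x : Fin 2 → ℝ, ∃ y : Fin d → ℝ,
      IsMinOn (fun y' => maxConstraint g (x, y')) Set.univ y)
    {n ℓ : ℕ} (hn : 0 < n) (hnV : V ≤ n * γ) (hnl : n ≤ 2 ^ ℓ) {z : Point 2 d}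
    (hz : z ∈ feasibleSet g) :
    ∃ alg : QueryAlgorithm 2 d,
      ∀ (f : Point 2 d → ℝ≥0∞) (ymin : (Fin 2 → ℝ) → (Fin d → ℝ)),
        ConvexOn ℝ≥0 Set.univ f →
        (∀ z ∈ feasibleSet g, f z < ⊤) →
        (∀ z ∈ feasibleSet g, ∀ w ∈ feasibleSet g, (f z).toReal - (f w).toReal ≤ V) →
        (∀ x : Fin 2 → ℝ, partialConstraint g x ≤ 0 →
          (x, ymin x) ∈ feasibleSet g ∧
          f (x, ymin x) ≤ partialMin (feasibleSet g) f x + ENNReal.ofReal γ) →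
        (alg.output f ymin).IsCorrect 0 (ENNReal.ofReal (kappa * γ)) (feasibleSet g) f z ∧
        alg.evaluations f ymin ≤ 1 + 11 * (2 * ℓ + 5) * (4 * ℓ + 2) ∧
        alg.minimizations f ymin ≤ 1 + 11 * (2 * ℓ + 5) * (4 * ℓ + 2) := by
  classical
  set S := feasibleSet g with hSdef
  have hS : Convex ℝ S := convex_feasibleSet hg
  set P : Set (Fin 2 → ℝ) := {x | ∃ y, (x, y) ∈ S} with hP
  have hPc : Convex ℝ P := by
    rintro x ⟨y, hy⟩ x' ⟨y', hy'⟩ a b ha hb hab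
    exact ⟨a • y + b • y', hS hy hy' ha hb hab⟩
  have hfinZ : {x : Fin 2 → ℤ | latticeVec x ∈ P}.Finite := by
    refine (Set.finite_Icc (fun _ : Fin 2 => -(B : ℤ)) fun _ => (B : ℤ)).subset ?_
    rintro x ⟨y, hy⟩
    have h : ∀ i, -(B : ℤ) ≤ x i ∧ x i ≤ B := fun i => by
      have := abs_le.1 (hB _ hy i)
      simp only [latticeVec] at this
      exact_mod_cast this
    exact ⟨fun i => (h i).1, fun i => (h i).2⟩
  set Z := hfinZ.toFinset with hZdef
  have hzP : z.1 ∈ P := ⟨z.2, hz⟩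
  -- The projection `P` need not be closed; `K` is compact and has the same lattice points.
  set K : Set (Fin 2 → ℝ) := convexHull ℝ (latticeVec '' Z ∪ {z.1}) with hKdef
  have hKconv : Convex ℝ K := convex_convexHull ℝ _
  have hKcomp : IsCompact K :=
    ((Z.finite_toSet.image latticeVec).union (Set.finite_singleton _)).isCompact_convexHull ℝ
  have hKP : K ⊆ P := by
    refine convexHull_min ?_ hPc
    rintro x (⟨a, ha, rfl⟩ | rfl)
    · exact hfinZ.mem_toFinset.1 ha
    · exact hzP
  have hzK : z.1 ∈ K := subset_convexHull ℝ _ (Or.inr rfl)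
  have hZ : ∀ x, x ∈ Z ↔ latticeVec x ∈ K := fun x =>
    ⟨fun hx => subset_convexHull ℝ _ (Or.inl ⟨x, hx, rfl⟩),
      fun hx => hfinZ.mem_toFinset.2 (hKP hx)⟩
  have hfacts : ∀ (f : Point 2 d → ℝ≥0∞) (ymin : (Fin 2 → ℝ) → (Fin d → ℝ)),
      ConvexOn ℝ≥0 Set.univ f → (∀ z ∈ S, f z < ⊤) →
      (∀ z ∈ S, ∀ w ∈ S, (f z).toReal - (f w).toReal ≤ V) →
      (∀ x : Fin 2 → ℝ, partialConstraint g x ≤ 0 → (x, ymin x) ∈ S ∧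
        f (x, ymin x) ≤ partialMin S f x + ENNReal.ofReal γ) →
      ConvexOn ℝ K (fun x => (partialMin S f x).toReal) ∧
      (∀ x ∈ K, ∀ y ∈ K, (partialMin S f x).toReal - (partialMin S f y).toReal ≤ V) ∧
      (∀ x ∈ K, (partialMin S f x).toReal ≤ (f (x, ymin x)).toReal ∧
        (f (x, ymin x)).toReal ≤ (partialMin S f x).toReal + γ) ∧
      (∀ c ∈ Z, (f (latticeVec c, ymin (latticeVec c))).toReal ≤ (f z).toReal + 5 * γ →
        (OracleReport.point (latticeVec c, ymin (latticeVec c))).IsCorrect 0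
          (ENNReal.ofReal (kappa * γ)) S f z) := by
    intro f ymin hf hfin hV hy
    have hfeas : ∀ x ∈ K, partialConstraint g x ≤ 0 := fun x hx => by
      obtain ⟨y, hxy⟩ := hKP hx
      exact partialConstraint_nonpos (hmin x) hxy
    refine ⟨(convexOn_toReal_partialMin hS hf hfin).subset hKP hKconv,
      fun x hx y hy => toReal_partialMin_sub_le hfin hV (hKP hx) (hKP hy), fun x hx => ?_,
      fun c hc hcf => ?_⟩
    · obtain ⟨h1, h2⟩ := hy x (hfeas x hx)
      have htop := (partialMin_lt_top hfin h1).ne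
      refine ⟨toReal_partialMin_le hfin h1, ?_⟩
      have := ENNReal.toReal_mono (ENNReal.add_ne_top.2 ⟨htop, ENNReal.ofReal_ne_top⟩) h2
      rwa [ENNReal.toReal_add htop ENNReal.ofReal_ne_top, ENNReal.toReal_ofReal hγ.le] at this
    · exact isImproving_of_toReal_le hfin hγ hz (hy _ (hfeas _ ((hZ c).1 hc))).1
        (fun i => ⟨c i, rfl⟩) hcf
  -- A lattice point in the copy shrunk towards `z.1` has `φ ≤ L + γ`, hence a probed value at most
  -- `L + 2 * γ`.
  by_cases hfree : ∃ w : Fin 2 → ℤ, ∃ k ∈ K, ∀ l, (n : ℝ) * (w l - z.1 l) = k l - z.1 l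
  · obtain ⟨w, k, hk, hw⟩ := hfree
    refine ⟨.probe (latticeVec w) fun y _ => .halt (.point (latticeVec w, y)), ?_⟩
    intro f ymin hf hfin hV hy
    obtain ⟨hφ, hφV, hφf, hpoint⟩ := hfacts f ymin hf hfin hV hy
    obtain ⟨hwK, hwL⟩ := le_add_of_contraction hφ hφV hn hnV hzK hk
      (toReal_partialMin_le hfin hz) (w := latticeVec w) hw
    simp only [QueryAlgorithm.probe, QueryAlgorithm.output, QueryAlgorithm.evaluations,
      QueryAlgorithm.minimizations]
    refine ⟨hpoint w ((hZ w).2 hwK) ?_, by omega, by omega⟩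
    have := (hφf _ hwK).2
    linarith
  obtain ⟨A, hAZ, hAcard, hA⟩ := exists_hitting_set K hKconv Z hZ n hn z.1 hfree
  have hp : ∀ x, latticeVec x ≠ z.1 := by
    intro x hx
    exact hfree ⟨x, z.1, hzK, fun l => by rw [← hx]; simp [latticeVec]⟩
  have hcut := exists_cut K hKconv hKcomp Z hZ z.1 hp
  choose! ctr hctr e R₁ R₂ hcut using hcut
  -- Two sections halve the interval at least, as `(2 / 3) ^ 2 ≤ 1 / 2`; eleven rounds halve the
  -- candidates, as `2 * 15 ^ 11 ≤ 16 ^ 11`; and `A.card ≤ (4 * n + 1) ^ 2 < 2 ^ (2 * ℓ + 5)`.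
  refine ⟨.evaluate z fun t => .latticeSearch t.toReal γ (2 * ℓ) ctr e R₁ R₂
    (11 * (2 * ℓ + 5)) A, ?_⟩
  intro f ymin hf hfin hV hy
  obtain ⟨hφ, hφV, hφf, hpoint⟩ := hfacts f ymin hf hfin hV hy
  have hnR : (n : ℝ) ≤ 2 ^ ℓ := by exact_mod_cast hnl
  have hpow : (2 / 3 : ℝ) ^ (2 * ℓ) * V ≤ 2 * γ := by
    have h1 : (2 / 3 : ℝ) ^ (2 * ℓ) ≤ (1 / 2) ^ ℓ := by
      rw [pow_mul]
      exact pow_le_pow_left₀ (by norm_num) (by norm_num) _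
    have h2 : (1 / 2 : ℝ) ^ ℓ * 2 ^ ℓ = 1 := by rw [← mul_pow]; norm_num
    calc (2 / 3 : ℝ) ^ (2 * ℓ) * V ≤ (2 / 3) ^ (2 * ℓ) * (2 ^ ℓ * γ) :=
          mul_le_mul_of_nonneg_left
            (hnV.trans (mul_le_mul_of_nonneg_right hnR hγ.le)) (by positivity)
      _ ≤ (1 / 2) ^ ℓ * (2 ^ ℓ * γ) := mul_le_mul_of_nonneg_right h1 (by positivity)
      _ = γ := by rw [← mul_assoc, h2, one_mul]
      _ ≤ 2 * γ := by linarith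
  have hcard : A.card * 15 ^ (11 * (2 * ℓ + 5)) < 16 ^ (11 * (2 * ℓ + 5)) := by
    have h1 : A.card < 2 ^ (2 * ℓ + 5) := by
      have : 2 ^ (2 * ℓ + 5) = 32 * (2 ^ ℓ) ^ 2 := by rw [pow_add, mul_comm 2 ℓ, pow_mul]; ring
      rw [this]
      nlinarith
    calc A.card * 15 ^ (11 * (2 * ℓ + 5)) < 2 ^ (2 * ℓ + 5) * 15 ^ (11 * (2 * ℓ + 5)) :=
          Nat.mul_lt_mul_of_pos_right h1 (by positivity)
      _ = (2 * 15 ^ 11) ^ (2 * ℓ + 5) := by rw [pow_mul, mul_pow]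
      _ ≤ (16 ^ 11) ^ (2 * ℓ + 5) := Nat.pow_le_pow_left (by norm_num) _
      _ = 16 ^ (11 * (2 * ℓ + 5)) := by rw [pow_mul]
  obtain ⟨h1, h2, h3⟩ := QueryAlgorithm.latticeSearch_spec f ymin hφ (L := (f z).toReal) hγ hφf hφV
    hzK (toReal_partialMin_le hfin hz) (fun x hx => (hZ x).1 hx) hAZ hpow
    (fun R hR hne => ⟨hctr R hR hne, hcut R hR hne⟩)
    (P := fun r => r.IsCorrect 0 (ENNReal.ofReal (kappa * γ)) S f z) hpoint
    (by
      rintro hall ⟨w, ⟨hwS, hwlat⟩, hwf⟩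
      choose x hx using hwlat
      have hwx : w.1 = latticeVec x := funext hx
      have hxZ : x ∈ Z := hfinZ.mem_toFinset.2 ⟨w.2, hwx ▸ hwS⟩
      -- A lattice point as good as `z` would force `φ ≤ L + γ` at a nearby point of `A`.
      obtain ⟨a, ha, y, hyZ, hay⟩ := hA x hxZ
      have hxL : (partialMin S f (latticeVec x)).toReal ≤ (f z).toReal := by
        rw [← hwx]
        exact (toReal_partialMin_le (y := w.2) hfin hwS).trans
          (ENNReal.toReal_mono (hfin z hz).ne hwf)
      have := (le_add_of_contraction hφ hφV hn hnV ((hZ x).1 hxZ) ((hZ y).1 hyZ) hxL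
        (w := latticeVec a) (fun l => by
          simp only [latticeVec]; exact_mod_cast hay l)).2
      exact absurd (hall a ha) (not_lt.2 this))
    (11 * (2 * ℓ + 5)) A subset_rfl (fun a ha hna => absurd ha hna) hcard
  have e : 11 * (2 * ℓ + 5) * (2 * (2 * ℓ) + 2) = 11 * (2 * ℓ + 5) * (4 * ℓ + 2) := by ring
  rw [e] at h2 h3
  simp only [QueryAlgorithm.output, QueryAlgorithm.evaluations, QueryAlgorithm.minimizations]
  exact ⟨h1, by omega, by omega⟩

/-- The number of binary digits of the accuracy is linear in the logarithm. -/
theorem exists_accuracy_bits {V γ : ℝ} (hγ : 0 < γ) (hV : 0 ≤ V) :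
    0 < ⌈max 1 (V / γ)⌉₊ ∧ V ≤ ⌈max 1 (V / γ)⌉₊ * γ ∧
      (Nat.clog 2 ⌈max 1 (V / γ)⌉₊ : ℝ) ≤ 2 + 2 * Real.posLog (V / γ) := by
  set t := max 1 (V / γ) with ht
  have ht1 : 1 ≤ t := le_max_left _ _
  have hlog : Real.posLog (V / γ) = Real.log t := Real.posLog_eq_log_max_one (by positivity)
  have hlog0 : 0 ≤ Real.log t := Real.log_nonneg ht1
  refine ⟨Nat.ceil_pos.2 (by linarith), ?_, ?_⟩
  · rw [← div_le_iff₀ hγ]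
    exact (le_max_right _ _).trans (Nat.le_ceil t)
  · rw [hlog]
    by_cases hn : 1 < ⌈t⌉₊
    · have h1 := Nat.pow_pred_clog_lt_self (b := 2) one_lt_two hn
      have hc : 0 < Nat.clog 2 ⌈t⌉₊ := Nat.clog_pos one_lt_two hn
      obtain ⟨j, hj⟩ : ∃ j, Nat.clog 2 ⌈t⌉₊ = j + 1 := ⟨_, (Nat.succ_pred_eq_of_pos hc).symm⟩
      rw [hj] at h1 ⊢
      have h2 : (2 : ℝ) ^ j < 2 * t := by
        have h3 : ((2 ^ j : ℕ) : ℝ) < ⌈t⌉₊ := by exact_mod_cast h1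
        have h4 := Nat.ceil_lt_add_one (show 0 ≤ t by linarith)
        push_cast at h3
        linarith
      have h3 := Real.log_lt_log (by positivity) h2
      rw [Real.log_pow, Real.log_mul (by norm_num) (by linarith)] at h3
      -- Only `log 2 > 1 / 2` matters here.
      have h4 := Real.log_two_gt_d9
      push_cast
      by_contra! hlt
      nlinarith
    · rw [Nat.clog_of_right_le_one (by omega)]
      push_cast
      linarith

end MixedInteger

theorem mainTheorem3 :
    ∃ p : Polynomial ℝ,
      ∀ (d m B : ℕ) (g : Fin m → MixedInteger.Point 2 d → ℝ) (V γ : ℝ),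
        0 < γ →
        (∀ i, ConvexOn ℝ Set.univ (g i)) →
        (∀ z ∈ MixedInteger.feasibleSet g, ∀ i, |z.1 i| ≤ (B : ℝ)) →
        (∀ x : Fin 2 → ℝ, ∃ y : Fin d → ℝ,
          IsMinOn (fun y' => MixedInteger.maxConstraint g (x, y')) Set.univ y) →
        ∃ oracle : MixedInteger.Point 2 d → MixedInteger.QueryAlgorithm 2 d,
          ∀ (f : MixedInteger.Point 2 d → ℝ≥0∞) (ymin : (Fin 2 → ℝ) → (Fin d → ℝ)),
            ConvexOn ℝ≥0 Set.univ f →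
            (∀ z ∈ MixedInteger.feasibleSet g, f z < ⊤) →
            (∀ z ∈ MixedInteger.feasibleSet g, ∀ w ∈ MixedInteger.feasibleSet g,
              (f z).toReal - (f w).toReal ≤ V) →
            (∀ x : Fin 2 → ℝ, MixedInteger.partialConstraint g x ≤ 0 →
              (x, ymin x) ∈ MixedInteger.feasibleSet g ∧
              f (x, ymin x) ≤
                MixedInteger.partialMin (MixedInteger.feasibleSet g) f x + ENNReal.ofReal γ) →
            ∀ z ∈ MixedInteger.feasibleSet g,
              ((oracle z).output f ymin).IsCorrect 0 (ENNReal.ofReal (MixedInteger.kappa * γ))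
                (MixedInteger.feasibleSet g) f z ∧
              ((oracle z).evaluations f ymin : ℝ) ≤ p.eval (Real.posLog (V / γ)) ∧
              ((oracle z).minimizations f ymin : ℝ) ≤ p.eval (Real.posLog (V / γ)) := by
  -- The cost bound of `exists_oracle_at` with `ℓ ≤ 2 + 2 * X` inserted.
  refine ⟨1 + Polynomial.C 11 * (Polynomial.C 4 * Polynomial.X + Polynomial.C 9) *
    (Polynomial.C 8 * Polynomial.X + Polynomial.C 10), ?_⟩
  intro d m B g V γ hγ hg hB hmin
  by_cases hV : 0 ≤ V
  swap
  · refine ⟨fun _ => .halt .noPoint, fun f ymin _ _ hfV _ z hz => ?_⟩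
    have := hfV z hz z hz
    exact absurd (by linarith) hV
  obtain ⟨hn, hnV, hl⟩ := MixedInteger.exists_accuracy_bits hγ hV
  set ℓ := Nat.clog 2 ⌈max 1 (V / γ)⌉₊
  have hnl : ⌈max 1 (V / γ)⌉₊ ≤ 2 ^ ℓ := Nat.le_pow_clog one_lt_two _
  have hex := fun (z : MixedInteger.Point 2 d) (hz : z ∈ MixedInteger.feasibleSet g) =>
    MixedInteger.exists_oracle_at hγ hg hB hmin hn hnV hnl hz
  have : Nonempty (MixedInteger.QueryAlgorithm 2 d) := ⟨.halt .noPoint⟩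
  choose! oracle horacle using hex
  refine ⟨oracle, fun f ymin hf hfin hfV hy z hz => ?_⟩
  obtain ⟨h1, h2, h3⟩ := horacle z hz f ymin hf hfin hfV hy
  have hbound : ((1 + 11 * (2 * ℓ + 5) * (4 * ℓ + 2) : ℕ) : ℝ) ≤
      1 + 11 * (4 * Real.posLog (V / γ) + 9) * (8 * Real.posLog (V / γ) + 10) := by
    have h0 : (0 : ℝ) ≤ ℓ := Nat.cast_nonneg ℓ
    push_cast
    gcongr ?_ + ?_ * ?_ * ?_ <;> linarith
  simp only [Polynomial.eval_add, Polynomial.eval_mul, Polynomial.eval_one, Polynomial.eval_C,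
    Polynomial.eval_X]
  exact ⟨h1, (Nat.cast_le.2 h2).trans hbound, (Nat.cast_le.2 h3).trans hbound⟩
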